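/- Let $K$ be a field, $Q$ a finite quiver, $\mathcal B$ the set of its finite directed paths (vertices included, as paths of length $0$), and $KQ$ the path algebra. Let $\succ$ be an admissible order on $\mathcal B$: a well-order such that $p\succ q$ implies $pr\succ qr$ and $sp\succ sq$ whenever these products are nonzero, and $rqs\succeq q$ whenever $rqs\neq 0$. The tip of a nonzero $x\in KQ$ is the $\succ$-largest path with nonzero coefficient in $x$. For an ideal $I$ (always two-sided) let $\operatorname{tip}(I)$ be the set of tips of its nonzero elements and $I_{Mon}=\langle \operatorname{tip}(I)\rangle$. If $\mathcal T_I$ is the unique minimal set of paths generating $I_{Mon}$, then for each $t\in\mathcal T_I$ there is a unique $g_t\in I$ with $t-g_t\in\operatorname{Span}_K(\mathcal B\setminus\operatorname{tip}(I))$, and $\{g_t\mid t\in\mathcal T_I\}$ is called the reduced Gröbner basis of $I$. Let $W:Q_1\to G$ be a weight function on the arrows with values in a group $G$, extended to $\mathcal B$ by $W(a_1\cdots a_n)=W(a_1)\cdots W(a_n)$ and $W(v)=1$ for vertices $v$. An ideal is weight homogeneous if it is generated by elements each of which is a linear combination of paths of one and the same weight. Let $\mathcal T\subset\mathcal B$ be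 a set of paths of length at least $2$, none of which is a subpath of another one, and let $\mathcal N$ be the set of paths that have no subpath in $\mathcal T$. For $t\in\mathcal T$ put $$\mathcal N(t)=\{n\in\mathcal N\mid n\parallel t,\ t\succ n\},\qquad \mathcal N^W(t)=\{n\in\mathcal N(t)\mid W(n)=W(t)\},$$ where $n\parallel t$ means that $n$ and $t$ have the same origin and the same terminus. Let $\mathcal V_{\mathcal T}$ (respectively $\mathcal V^W_{\mathcal T}$) be the set of arrays $\mathbf c=(c_{t,n})$ of elements of $K$, indexed by $t\in\mathcal T$ and $n\in\mathcal N(t)$ (respectively $n\in\mathcal N^W(t)$), with only finitely many nonzero entries for each $t$, such that $\mathcal G_{\mathbf c}=\{t-\sum_n c_{t,n}n\mid t\in\mathcal T\}$ is the reduced Gröbner basis of the ideal $\langle\mathcal G_{\mathbf c}\rangle$. For subsets $\mathcal S(t)\subseteq\mathcal N(t)$ and maps $\varphi_t:\mathcal S(t)\to K$ let $\mathcal V_{\mathcal T}(\varphi)$ be the set of $\mathbf c\in\mathcal V_{\mathcal T}$ with $c_{t,n}=\varphi_t(n)$ for all $t\in\mathcal T$ and $n\in\mathcal S(t)$. Take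 $\mathcal S(t)=\mathcal N(t)\setminus\mathcal N^W(t)$ and $\varphi_t\equiv 0$ for all $t$. Then: 1. The map $\mathbf c\mapsto\langle\mathcal G_{\mathbf c}\rangle$ is a bijection from $\mathcal V^W_{\mathcal T}$ onto the set of weight homogeneous ideals $I$ of $KQ$ with $I_{Mon}=\langle\mathcal T\rangle$. 2. Extension by zero (setting $c_{t,n}=0$ for $W(n)\neq W(t)$) is an isomorphism $\mathcal V^W_{\mathcal T}\simeq\mathcal V_{\mathcal T}(\varphi)$, that is, a bijection given in both directions by polynomials in the coordinates. 3. If $\mathcal T$ is finite and all $\mathcal N^W(t)$, $t\in\mathcal T$, are finite, then $\mathcal V^W_{\mathcal T}$ is an affine algebraic variety, that is, the zero set of a set of polynomials in the coordinates $c_{t,n}$. If $\mathcal T$ and all $\mathcal N(t)$, $t\in\mathcal T$, are finite, then $\mathcal V_{\mathcal T}$ and its special subvariety $\mathcal V_{\mathcal T}(\varphi)$ are affine algebraic varieties as well. -/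

import Mathlib

/-! Path algebras, tips and reduced Groebner bases, and the varieties attached to a set of paths. -/

universe u v w x

noncomputable section

namespace PathAlg

/-- The set `ℬ` of finite directed paths of a quiver, trivial paths at vertices included.
A path is written in the order in which its arrows are traversed. -/
abbrev Paths (V : Type u) [Quiver.{v} V] : Type (max u v) :=
  Σ a b : V, Quiver.Path a b

/-- The underlying vector space of the path algebra `KQ`: it has `ℬ` as a basis. -/
def KQ (K : Type w) (V : Type u) [Quiver.{v} V] [Field K] : Type (max (max u v) w) :=
  Paths V →₀ K

section Ring

variable {K : Type w} {V : Type u} [Quiver.{v} V] [Field K]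

instance : AddCommGroup (KQ K V) := inferInstanceAs (AddCommGroup (Paths V →₀ K))

instance : Module K (KQ K V) := inferInstanceAs (Module K (Paths V →₀ K))

/-- The coefficient of the path `p` in `x`. -/
def coeff (x : KQ K V) (p : Paths V) : K := (show Paths V →₀ K from x) p

/-- A path as an element of the path algebra. -/
def ofPath (p : Paths V) : KQ K V := (Finsupp.single p 1 : Paths V →₀ K)

open Classical in
/-- The product of two paths: their concatenation if the first ends where the second starts,
and `0` otherwise. -/
def pathMul : Paths V → Paths V → KQ K V
  | ⟨a, b, p⟩, ⟨c, d, q⟩ =>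
    if h : c = b then ofPath ⟨a, d, p.comp (q.cast h rfl)⟩ else 0

/-- The linear extension of a function on paths. -/
def lift {M : Type*} [AddCommGroup M] [Module K M] (f : Paths V → M) : KQ K V →ₗ[K] M :=
  (Finsupp.linearCombination K f : (Paths V →₀ K) →ₗ[K] M)

theorem lift_ofPath {M : Type*} [AddCommGroup M] [Module K M] (f : Paths V → M) (p : Paths V) :
    lift (K := K) f (ofPath p) = f p :=
  (Finsupp.linearCombination_single K 1 p).trans (one_smul K (f p))

/-- The bilinear extension of the product of paths. -/
def mulHom : KQ K V →ₗ[K] KQ K V →ₗ[K] KQ K V := lift fun p => lift (pathMul p)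

instance : Mul (KQ K V) := ⟨fun x y => mulHom x y⟩

/-- The identity of the path algebra is the sum of the trivial paths. -/
instance [Fintype V] : One (KQ K V) := ⟨∑ a : V, ofPath ⟨a, a, Quiver.Path.nil⟩⟩

theorem mul_def (x y : KQ K V) : x * y = mulHom x y := rfl

theorem one_def [Fintype V] : (1 : KQ K V) = ∑ a : V, ofPath ⟨a, a, Quiver.Path.nil⟩ := rfl

theorem ofPath_mul (p q : Paths V) : (ofPath p * ofPath q : KQ K V) = pathMul p q := by
  rw [mul_def, mulHom, lift_ofPath, lift_ofPath]

theorem ofPath_mul_comp {a b c : V} (p : Quiver.Path a b) (q : Quiver.Path b c) :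
    (ofPath ⟨a, b, p⟩ * ofPath ⟨b, c, q⟩ : KQ K V) = ofPath ⟨a, c, p.comp q⟩ := by
  rw [ofPath_mul, pathMul, dif_pos rfl]
  rfl

theorem ofPath_mul_of_ne {a b c d : V} (p : Quiver.Path a b) (q : Quiver.Path c d) (h : c ≠ b) :
    (ofPath ⟨a, b, p⟩ * ofPath ⟨c, d, q⟩ : KQ K V) = 0 := by
  rw [ofPath_mul, pathMul, dif_neg h]

theorem induction_on {P : KQ K V → Prop} (x : KQ K V) (h0 : P 0)
    (hadd : ∀ x y, P x → P y → P (x + y)) (hs : ∀ (c : K) (p : Paths V), P (c • ofPath p)) :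
    P x := by
  refine Finsupp.induction_linear (motive := P) x h0 (fun f g => hadd f g) ?_
  intro p c
  have h : (Finsupp.single p c : Paths V →₀ K) = c • Finsupp.single p 1 := by simp
  rw [h]
  exact hs c p

theorem add_mul' (x y z : KQ K V) : (x + y) * z = x * z + y * z := by
  simp only [mul_def, map_add, LinearMap.add_apply]

theorem mul_add' (x y z : KQ K V) : x * (y + z) = x * y + x * z := by
  simp only [mul_def, map_add]

theorem zero_mul' (x : KQ K V) : 0 * x = 0 := by
  simp only [mul_def, map_zero, LinearMap.zero_apply]

theorem mul_zero' (x : KQ K V) : x * 0 = 0 := by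
  simp only [mul_def, map_zero]

theorem smul_mul' (c : K) (x y : KQ K V) : (c • x) * y = c • (x * y) := by
  simp only [mul_def, map_smul, LinearMap.smul_apply]

theorem mul_smul' (c : K) (x y : KQ K V) : x * (c • y) = c • (x * y) := by
  simp only [mul_def, map_smul]

theorem ofPath_mul_assoc (p q r : Paths V) :
    (ofPath p * ofPath q * ofPath r : KQ K V) = ofPath p * (ofPath q * ofPath r) := by
  obtain ⟨a, b, p⟩ := p
  obtain ⟨c, d, q⟩ := q
  obtain ⟨e, f, r⟩ := r
  by_cases h1 : c = b
  · subst h1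
    by_cases h2 : e = d
    · subst h2
      simp only [ofPath_mul_comp, Quiver.Path.comp_assoc]
    · rw [ofPath_mul_comp, ofPath_mul_of_ne _ _ h2, ofPath_mul_of_ne _ _ h2, mul_zero']
  · rw [ofPath_mul_of_ne _ _ h1, zero_mul']
    by_cases h2 : e = d
    · subst h2
      rw [ofPath_mul_comp, ofPath_mul_of_ne _ _ h1]
    · rw [ofPath_mul_of_ne _ _ h2, mul_zero']

theorem mul_assoc' (x y z : KQ K V) : x * y * z = x * (y * z) := by
  induction x using induction_on with
  | h0 => simp only [zero_mul']
  | hadd x x' h h' => simp only [add_mul', h, h']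
  | hs c p =>
    induction y using induction_on with
    | h0 => simp only [zero_mul', mul_zero']
    | hadd y y' h h' => simp only [add_mul', mul_add', h, h']
    | hs d q =>
      induction z using induction_on with
      | h0 => simp only [mul_zero']
      | hadd z z' h h' => simp only [mul_add', h, h']
      | hs e r => simp only [smul_mul', mul_smul', ofPath_mul_assoc]

theorem one_mul' [Fintype V] (x : KQ K V) : 1 * x = x := by
  induction x using induction_on with
  | h0 => exact mul_zero' _
  | hadd x y h h' => rw [mul_add', h, h']
  | hs c p =>
    obtain ⟨a, b, p⟩ := p
    rw [mul_smul', one_def, mul_def, map_sum, LinearMap.sum_apply, Finset.sum_eq_single a]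
    · rw [← mul_def, ofPath_mul_comp, Quiver.Path.nil_comp]
    · intro d _ hd
      exact ofPath_mul_of_ne _ _ hd.symm
    · intro h
      exact absurd (Finset.mem_univ a) h

theorem mul_one' [Fintype V] (x : KQ K V) : x * 1 = x := by
  induction x using induction_on with
  | h0 => exact zero_mul' _
  | hadd x y h h' => rw [add_mul', h, h']
  | hs c p =>
    obtain ⟨a, b, p⟩ := p
    rw [smul_mul', one_def, mul_def, map_sum, Finset.sum_eq_single b]
    · rw [← mul_def, ofPath_mul_comp, Quiver.Path.comp_nil]
    · intro d _ hd
      exact ofPath_mul_of_ne _ _ hd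
    · intro h
      exact absurd (Finset.mem_univ b) h

/-- The path algebra of a quiver with finitely many vertices. -/
instance [Fintype V] : Ring (KQ K V) :=
  { (inferInstance : AddCommGroup (KQ K V)) with
    mul := (· * ·)
    one := 1
    left_distrib := mul_add'
    right_distrib := add_mul'
    zero_mul := zero_mul'
    mul_zero := mul_zero'
    mul_assoc := mul_assoc'
    one_mul := one_mul'
    mul_one := mul_one' }

instance [Fintype V] : Algebra K (KQ K V) := Algebra.ofModule smul_mul' mul_smul'

end Ring

section Paths

variable {V : Type u} [Quiver.{v} V]

/-- `lt q p` stands for `p ≻ q`.  The condition that a product of paths is nonzero is expressed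
by the types of the paths: exactly the composable paths have a nonzero product. -/
structure IsAdmissibleOrder (lt : Paths V → Paths V → Prop) : Prop where
  isWellOrder : IsWellOrder (Paths V) lt
  mul_right : ∀ {a b a' c : V} (p : Quiver.Path a b) (q : Quiver.Path a' b) (r : Quiver.Path b c),
    lt ⟨a', b, q⟩ ⟨a, b, p⟩ → lt ⟨a', c, q.comp r⟩ ⟨a, c, p.comp r⟩
  mul_left : ∀ {a b b' c : V} (p : Quiver.Path a b) (q : Quiver.Path a b') (s : Quiver.Path c a),
    lt ⟨a, b', q⟩ ⟨a, b, p⟩ → lt ⟨c, b', s.comp q⟩ ⟨c, b, s.comp p⟩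
  subpath_le : ∀ {a b c d : V} (r : Quiver.Path a b) (q : Quiver.Path b c) (s : Quiver.Path c d),
    lt ⟨b, c, q⟩ ⟨a, d, r.comp (q.comp s)⟩ ∨
      (⟨b, c, q⟩ : Paths V) = ⟨a, d, r.comp (q.comp s)⟩

/-- `p ∣ q`: the path `p` is a subpath of `q`, that is, `q = r p s` for some paths `r`, `s`. -/
def IsSubpath (p q : Paths V) : Prop :=
  ∃ (r : Quiver.Path q.1 p.1) (s : Quiver.Path p.2.1 q.2.1), q.2.2 = r.comp (p.2.2.comp s)

/-- No element of `T` is a subpath of another one. -/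
def IsTipReduced (T : Set (Paths V)) : Prop :=
  ∀ t ∈ T, ∀ t' ∈ T, t ≠ t' → ¬ IsSubpath t t'

/-- Paths with the same origin and the same terminus. -/
def Parallel (p q : Paths V) : Prop := p.1 = q.1 ∧ p.2.1 = q.2.1

/-- The length of a path. -/
def len (p : Paths V) : ℕ := p.2.2.length

/-- The extension `W(a₁ ⋯ aₙ) = W(a₁) ⋯ W(aₙ)` of a weight function to paths;
trivial paths have weight `1`. -/
def weight {G : Type*} [Group G] (W : ∀ {a b : V}, (a ⟶ b) → G) (p : Paths V) : G :=
  p.2.2.weight W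

/-- `𝒩`: the paths that have no subpath in `T`. -/
def nontips (T : Set (Paths V)) : Set (Paths V) := {p | ∀ t ∈ T, ¬ IsSubpath t p}

/-- `𝒩(t) = {n ∈ 𝒩 | n ∥ t, t ≻ n}`. -/
def nontipsOf (T : Set (Paths V)) (lt : Paths V → Paths V → Prop) (t : Paths V) :
    Set (Paths V) :=
  {n | n ∈ nontips T ∧ Parallel n t ∧ lt n t}

/-- `𝒩^W(t) = {n ∈ 𝒩(t) | W(n) = W(t)}`. -/
def gradedNontipsOf {G : Type*} [Group G] (T : Set (Paths V)) (lt : Paths V → Paths V → Prop)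
    (W : ∀ {a b : V}, (a ⟶ b) → G) (t : Paths V) : Set (Paths V) :=
  {n | n ∈ nontipsOf T lt t ∧ weight W n = weight W t}

end Paths

section Groebner

variable {K : Type w} {V : Type u} [Quiver.{v} V] [Field K]

/-- `p = tip(x)`; a nonzero `x` has exactly one tip, and `0` has none. -/
def IsTip (lt : Paths V → Paths V → Prop) (x : KQ K V) (p : Paths V) : Prop :=
  coeff x p ≠ 0 ∧ ∀ q, coeff x q ≠ 0 → q = p ∨ lt q p

/-- `tip(X)`, the set of tips of the nonzero elements of `X`. -/
def tips (lt : Paths V → Paths V → Prop) (X : Set (KQ K V)) : Set (Paths V) :=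
  {p | ∃ x ∈ X, x ≠ 0 ∧ IsTip lt x p}

variable [Fintype V]

variable (K) in
/-- The two-sided ideal `⟨P⟩` of `KQ` generated by a set of paths. -/
def monomialIdeal (P : Set (Paths V)) : TwoSidedIdeal (KQ K V) :=
  TwoSidedIdeal.span (ofPath '' P)

/-- `I_Mon = ⟨tip(I)⟩`. -/
def assocMonomialIdeal (lt : Paths V → Paths V → Prop) (I : TwoSidedIdeal (KQ K V)) :
    TwoSidedIdeal (KQ K V) :=
  monomialIdeal K (tips lt {x | x ∈ I})

/-- `X` is the reduced Groebner basis of `I`: for the minimal set `T` of paths that generates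
`I_Mon`, the set `X` consists of the elements `g_t ∈ I`, `t ∈ T`, for which `t - g_t` lies in the
span of the paths outside `tip(I)`. -/
def IsReducedGroebnerBasis (lt : Paths V → Paths V → Prop) (I : TwoSidedIdeal (KQ K V))
    (X : Set (KQ K V)) : Prop :=
  ∃ T : Set (Paths V),
    Minimal (fun P : Set (Paths V) => monomialIdeal K P = assocMonomialIdeal lt I) T ∧
    X = {g | g ∈ I ∧ ∃ t ∈ T,
      ofPath t - g ∈ Submodule.span K (ofPath '' (tips lt {x | x ∈ I})ᶜ)}

variable (K) in
/-- The homogeneous component `KQ_g`, the span of the paths of weight `g`. -/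
def weightSpace {G : Type*} [Group G] (W : ∀ {a b : V}, (a ⟶ b) → G) (g : G) :
    Submodule K (KQ K V) :=
  Submodule.span K (ofPath '' {p | weight W p = g})

/-- `I` can be generated by weight homogeneous elements. -/
def IsWeightHomogeneous {G : Type*} [Group G] (W : ∀ {a b : V}, (a ⟶ b) → G)
    (I : TwoSidedIdeal (KQ K V)) : Prop :=
  ∃ S : Set (KQ K V), (∀ x ∈ S, ∃ g : G, x ∈ weightSpace K W g) ∧ TwoSidedIdeal.span S = I

variable (K) in
/-- The ideals `I` for which `KQ / I` belongs to `Alg_T^W`: the weight homogeneous ideals with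
`I_Mon = ⟨T⟩`. -/
def gradedIdeals {G : Type*} [Group G] (T : Set (Paths V)) (lt : Paths V → Paths V → Prop)
    (W : ∀ {a b : V}, (a ⟶ b) → G) : Set (TwoSidedIdeal (KQ K V)) :=
  {I | IsWeightHomogeneous W I ∧ assocMonomialIdeal lt I = monomialIdeal K T}

end Groebner

section Varieties

variable {K : Type w} {V : Type u} [Quiver.{v} V] [Field K]

/-- The pairs `(t, n)` with `t ∈ T` and `n ∈ M(t)`, which index the coordinates `c_{t,n}`. -/
abbrev Index (T : Set (Paths V)) (M : Paths V → Set (Paths V)) : Type (max u v) :=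
  Σ t : T, M t.1

/-- `g_t = t - ∑_{n ∈ M(t)} c_{t,n} n`. -/
def gen {T : Set (Paths V)} {M : Paths V → Set (Paths V)} (c : Index T M → K) (t : T) : KQ K V :=
  ofPath t.1 - ∑ᶠ n : M t.1, c ⟨t, n⟩ • ofPath n.1

variable [Fintype V]

/-- The ideal generated by all `g_t`, `t ∈ T`. -/
def idealOf {T : Set (Paths V)} {M : Paths V → Set (Paths V)} (c : Index T M → K) :
    TwoSidedIdeal (KQ K V) :=
  TwoSidedIdeal.span (Set.range (gen c))

variable (K) in
/-- The points `c` for which `{g_t | t ∈ T}` is the reduced Groebner basis of the ideal that it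
generates.  The sums in the `g_t` are to be finite, which is automatic if all `M(t)` are finite. -/
def pointsWith (T : Set (Paths V)) (M : Paths V → Set (Paths V))
    (lt : Paths V → Paths V → Prop) : Set (Index T M → K) :=
  {c | (∀ t : T, {n : M t.1 | c ⟨t, n⟩ ≠ 0}.Finite) ∧
    IsReducedGroebnerBasis lt (idealOf c) (Set.range (gen c))}

variable (K) in
/-- `𝒱_T`. -/
def variety (T : Set (Paths V)) (lt : Paths V → Paths V → Prop) :
    Set (Index T (nontipsOf T lt) → K) :=
  pointsWith K T (nontipsOf T lt) lt

variable (K) in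
/-- `𝒱_T^W`. -/
def gradedVariety {G : Type*} [Group G] (T : Set (Paths V)) (lt : Paths V → Paths V → Prop)
    (W : ∀ {a b : V}, (a ⟶ b) → G) : Set (Index T (gradedNontipsOf T lt W) → K) :=
  pointsWith K T (gradedNontipsOf T lt W) lt

/-- `𝒱_T(φ)`: the points of `𝒱_T` with `c_{t,n} = φ_t(n)` for all `t ∈ T` and `n ∈ S(t)`. -/
def specialSubvariety (T : Set (Paths V)) (lt : Paths V → Paths V → Prop)
    (S : Paths V → Set (Paths V)) (φ : ∀ t : T, S t.1 → K) :
    Set (Index T (nontipsOf T lt) → K) :=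
  {c | c ∈ variety K T lt ∧
    ∀ (t : T) (n : nontipsOf T lt t.1) (hn : n.1 ∈ S t.1), c ⟨t, n⟩ = φ t ⟨n.1, hn⟩}

/-- An affine algebraic variety: the zero set of polynomials (not necessarily irreducible). -/
def IsAffineVariety {σ : Type*} (X : Set (σ → K)) : Prop :=
  ∃ I : Ideal (MvPolynomial σ K), X = MvPolynomial.zeroLocus K I

/-- A map between subsets of affine spaces is a morphism if its coordinates are polynomials. -/
def IsMorphism {σ τ : Type*} {X : Set (σ → K)} {Y : Set (τ → K)} (f : X → Y) : Prop :=
  ∃ F : τ → MvPolynomial σ K, ∀ (x : X) (j : τ), (f x).1 j = MvPolynomial.eval x.1 (F j)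

end Varieties

end PathAlg

end

/-! Normal forms modulo two-sided ideals of a path algebra, and the equations of the varieties
attached to a set of paths. -/

noncomputable section

namespace PathAlg

/-! ### Division with remainder along a well-founded order -/

section Reduction

/-! Everything rests on division with remainder. Modulo an ideal I each tip is congruent to a
combination of smaller paths, so by well-founded induction every element has a remainder supported
outside tip(I). The remainder is unique, because a nonzero element of I has a tip
(`eq_zero_of_mem_of_mem_pathSpan`). Write I_c for the ideal generated by the g_t. Then 𝒢_c is its
reduced Gröbner basis iff tip(I_c) is the complement of 𝒩, iff I_c ∩ Span 𝒩 = 0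
(`isReducedGroebnerBasis_iff`, `tips_idealOf_eq_iff`).

Points and ideals: c is recovered from I_c, since t - g_t is the remainder of t. Conversely, a
weight homogeneous ideal is stable under projection to the paths parallel to t and to those of a
given weight, so the remainder of t can be taken in Span 𝒩^W(t) (`exists_homogeneous_normalForm`).
The resulting g_t generate the ideal because division by them leaves remainder 0. Extension by zero
does not change the g_t at all.

Equations: each g_t has leading coefficient 1, so division works with the c_{t,n} replaced by
variables. This yields, for every c, a linear map N_c with polynomial entries, with values in Span
𝒩, equal to the identity there, and with N_c x ≡ x modulo I_c. Hence I_c ∩ Span 𝒩 = 0 iff N_c kills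
I_c, iff it kills all r g_t s with paths r, s. The coefficients of N_c(r g_t s) are the equations
(`isAffineVariety_pointsWith`). -/

/-- Reduction with respect to a well-founded order: if modulo `J` every element of `U` is congruent
to a combination of smaller elements, then every basis element is congruent modulo `J` to a
combination of elements outside `U` which are not bigger. -/
theorem single_mem_supported_sup {α R : Type*} [Ring R] {lt : α → α → Prop} (hwf : WellFounded lt)
    (htrans : ∀ {p q r}, lt p q → lt q r → lt p r) (U : Set α) (J : Submodule R (α →₀ R))
    (hU : ∀ p ∈ U, ∃ h ∈ Finsupp.supported R R {q | lt q p}, Finsupp.single p 1 - h ∈ J) (p : α) :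
    Finsupp.single p 1 ∈ Finsupp.supported R R (Uᶜ ∩ {q | q = p ∨ lt q p}) ⊔ J := by
  induction p using hwf.induction with
  | _ p ih =>
    by_cases hp : p ∈ U
    · obtain ⟨h, hh, hJ⟩ := hU p hp
      -- Replace p by h modulo `J`; all terms of h are smaller than p, so the induction hypothesis
      -- applies to each.
      rw [← sub_add_cancel (Finsupp.single p (1 : R)) h]
      refine add_mem (Submodule.mem_sup_right hJ) ?_
      rw [Finsupp.supported_eq_span_single] at hh
      refine (Submodule.span_le.2 ?_ : _ ≤ _) hh
      rintro _ ⟨q, hq, rfl⟩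
      have hle : Finsupp.supported R R (Uᶜ ∩ {s | s = q ∨ lt s q}) ≤
          Finsupp.supported R R (Uᶜ ∩ {s | s = p ∨ lt s p}) := by
        refine Finsupp.supported_mono ?_
        rintro s ⟨hs, rfl | hs'⟩
        · exact ⟨hs, Or.inr hq⟩
        · exact ⟨hs, Or.inr (htrans hs' hq)⟩
      exact sup_le_sup_right hle _ (ih q hq)
    · exact Submodule.mem_sup_left (Finsupp.single_mem_supported R 1 ⟨hp, Or.inl rfl⟩)

end Reduction

/-! ### Coefficients, spans of paths and projections onto them -/

section PathSpan

variable {K : Type w} {V : Type u} [Quiver.{v} V] [Field K]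

theorem ext_coeff {x y : KQ K V} (h : ∀ p, coeff x p = coeff y p) : x = y :=
  Finsupp.ext h

/-- The coefficient of a path as a linear form. -/
def coeffHom (p : Paths V) : KQ K V →ₗ[K] K := (Finsupp.lapply p : (Paths V →₀ K) →ₗ[K] K)

theorem coeffHom_apply (p : Paths V) (x : KQ K V) : coeffHom p x = coeff x p := rfl

theorem coeff_zero (p : Paths V) : coeff (0 : KQ K V) p = 0 := rfl

theorem coeff_sub (x y : KQ K V) (p : Paths V) : coeff (x - y) p = coeff x p - coeff y p := rfl

theorem coeff_smul (c : K) (x : KQ K V) (p : Paths V) : coeff (c • x) p = c * coeff x p := rfl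

theorem coeff_ofPath_self (p : Paths V) : coeff (ofPath p : KQ K V) p = 1 :=
  Finsupp.single_eq_same

theorem coeff_ofPath_of_ne {p q : Paths V} (h : q ≠ p) : coeff (ofPath p : KQ K V) q = 0 :=
  Finsupp.single_eq_of_ne h

variable (K) in
/-- The subspace spanned by a set of paths. -/
def pathSpan (s : Set (Paths V)) : Submodule K (KQ K V) := Submodule.span K (ofPath '' s)

theorem pathSpan_eq_supported (s : Set (Paths V)) :
    (pathSpan K s : Submodule K (Paths V →₀ K)) = Finsupp.supported K K s :=
  (Finsupp.supported_eq_span_single K s).symm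

theorem mem_pathSpan {s : Set (Paths V)} {x : KQ K V} :
    x ∈ pathSpan K s ↔ ∀ p, coeff x p ≠ 0 → p ∈ s := by
  have h : x ∈ pathSpan K s ↔ (x : Paths V →₀ K) ∈ Finsupp.supported K K s :=
    iff_of_eq (congrArg (fun M : Submodule K (Paths V →₀ K) => (x : Paths V →₀ K) ∈ M)
      (pathSpan_eq_supported s))
  refine h.trans ((Finsupp.mem_supported K _).trans ?_)
  exact ⟨fun h p hp => h (Finsupp.mem_support_iff.2 hp),
    fun h p hp => h p (Finsupp.mem_support_iff.1 hp)⟩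

theorem coeff_eq_zero_of_mem_pathSpan {s : Set (Paths V)} {x : KQ K V} (hx : x ∈ pathSpan K s)
    {p : Paths V} (hp : p ∉ s) : coeff x p = 0 := by
  by_contra h
  exact hp (mem_pathSpan.1 hx p h)

theorem ofPath_mem_pathSpan {s : Set (Paths V)} {p : Paths V} (hp : p ∈ s) :
    (ofPath p : KQ K V) ∈ pathSpan K s :=
  Submodule.subset_span ⟨p, hp, rfl⟩

theorem mem_of_ofPath_mem_pathSpan {s : Set (Paths V)} {p : Paths V}
    (hp : (ofPath p : KQ K V) ∈ pathSpan K s) : p ∈ s :=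
  mem_pathSpan.1 hp p (by rw [coeff_ofPath_self]; exact one_ne_zero)

theorem pathSpan_mono {s t : Set (Paths V)} (h : s ⊆ t) : pathSpan K s ≤ pathSpan K t :=
  Submodule.span_mono (Set.image_mono h)

theorem pathSpan_le {s : Set (Paths V)} {M : Submodule K (KQ K V)} :
    pathSpan K s ≤ M ↔ ∀ p ∈ s, ofPath p ∈ M := by
  rw [pathSpan, Submodule.span_le, Set.image_subset_iff]
  rfl

theorem mem_pathSpan_univ (x : KQ K V) : x ∈ pathSpan K Set.univ :=
  mem_pathSpan.2 fun _ _ => trivial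

theorem eq_of_coeff_eq_of_mem_pathSpan {s : Set (Paths V)} {x y : KQ K V} (hx : x ∈ pathSpan K s)
    (hy : y ∈ pathSpan K s) (h : ∀ p ∈ s, coeff x p = coeff y p) : x = y := by
  refine ext_coeff fun p => ?_
  by_cases hp : p ∈ s
  · exact h p hp
  · rw [coeff_eq_zero_of_mem_pathSpan hx hp, coeff_eq_zero_of_mem_pathSpan hy hp]

theorem linearMap_ext {M : Type*} [AddCommGroup M] [Module K M] {f g : KQ K V →ₗ[K] M}
    (h : ∀ p, f (ofPath p) = g (ofPath p)) : f = g := by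
  refine LinearMap.ext fun x => ?_
  induction x using induction_on with
  | h0 => rw [map_zero, map_zero]
  | hadd x y hx hy => rw [map_add, map_add, hx, hy]
  | hs c p => rw [map_smul, map_smul, h]

open Classical in
/-- The projection onto the span of a set of paths. -/
def restrict (s : Set (Paths V)) : KQ K V →ₗ[K] KQ K V :=
  lift fun p => if p ∈ s then ofPath p else 0

theorem restrict_ofPath_of_mem {s : Set (Paths V)} {p : Paths V} (hp : p ∈ s) :
    restrict s (ofPath p : KQ K V) = ofPath p := by
  rw [restrict, lift_ofPath, if_pos hp]

theorem restrict_ofPath_of_notMem {s : Set (Paths V)} {p : Paths V} (hp : p ∉ s) :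
    restrict s (ofPath p : KQ K V) = 0 := by
  rw [restrict, lift_ofPath, if_neg hp]

theorem restrict_mem_pathSpan_inter {s t : Set (Paths V)} {x : KQ K V} (hx : x ∈ pathSpan K t) :
    restrict s x ∈ pathSpan K (t ∩ s) := by
  refine (pathSpan_le.2 ?_ : pathSpan K t ≤ (pathSpan K (t ∩ s)).comap (restrict s)) hx
  intro p hp
  rw [Submodule.mem_comap]
  by_cases h : p ∈ s
  · rw [restrict_ofPath_of_mem h]
    exact ofPath_mem_pathSpan ⟨hp, h⟩
  · rw [restrict_ofPath_of_notMem h]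
    exact zero_mem _

theorem restrict_eq_self {s : Set (Paths V)} {x : KQ K V} (hx : x ∈ pathSpan K s) :
    restrict s x = x := by
  refine (pathSpan_le.2 ?_ : pathSpan K s ≤ LinearMap.eqLocus (restrict s) LinearMap.id) hx
  intro p hp
  exact restrict_ofPath_of_mem hp

theorem restrict_eq_zero {s t : Set (Paths V)} (hst : Disjoint t s) {x : KQ K V}
    (hx : x ∈ pathSpan K t) : restrict s x = 0 := by
  refine (pathSpan_le.2 ?_ : pathSpan K t ≤ LinearMap.ker (restrict s)) hx
  intro p hp
  exact restrict_ofPath_of_notMem (Set.disjoint_left.1 hst hp)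

section Finsum

variable {M : Set (Paths V)}

theorem hasFiniteSupport_smul_ofPath {f : M → K} (hf : {n | f n ≠ 0}.Finite) :
    (Function.support fun n : M => f n • (ofPath n.1 : KQ K V)).Finite := by
  refine hf.subset fun n hn h => hn ?_
  simp only [h, zero_smul]

theorem finsum_smul_ofPath_mem (f : M → K) :
    ∑ᶠ n : M, f n • (ofPath n.1 : KQ K V) ∈ pathSpan K M :=
  finsum_induction (· ∈ pathSpan K M) (zero_mem _) (fun _ _ => add_mem)
    fun n => Submodule.smul_mem _ _ (ofPath_mem_pathSpan n.2)

theorem coeff_finsum_smul_ofPath {f : M → K} (hf : {n | f n ≠ 0}.Finite) (m : M) :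
    coeff (∑ᶠ n : M, f n • (ofPath n.1 : KQ K V)) m.1 = f m := by
  rw [← coeffHom_apply, ← LinearMap.toAddMonoidHom_coe,
    AddMonoidHom.map_finsum _ (hasFiniteSupport_smul_ofPath hf), finsum_eq_single _ m]
  · rw [LinearMap.toAddMonoidHom_coe, coeffHom_apply, coeff_smul, coeff_ofPath_self, mul_one]
  · intro n hn
    rw [LinearMap.toAddMonoidHom_coe, coeffHom_apply, coeff_smul,
      coeff_ofPath_of_ne (fun h => hn (Subtype.ext h.symm)), mul_zero]

theorem finite_coeff_ne_zero (x : KQ K V) : {n : M | coeff x n.1 ≠ 0}.Finite := by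
  have h : {p | coeff x p ≠ 0}.Finite :=
    ((x : Paths V →₀ K).support.finite_toSet).subset fun p hp => Finsupp.mem_support_iff.2 hp
  exact h.preimage Subtype.val_injective.injOn

theorem finsum_coeff_smul_ofPath {x : KQ K V} (hx : x ∈ pathSpan K M) :
    ∑ᶠ n : M, coeff x n.1 • (ofPath n.1 : KQ K V) = x :=
  eq_of_coeff_eq_of_mem_pathSpan (finsum_smul_ofPath_mem _) hx fun p hp =>
    coeff_finsum_smul_ofPath (finite_coeff_ne_zero x) ⟨p, hp⟩

end Finsum

end PathSpan

/-! ### Multiplication by paths on both sides, and generated ideals -/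

section Sandwich

variable {K : Type w} {V : Type u} [Quiver.{v} V] [Field K]

/-- The map `x ↦ r x s` for paths `r` and `s`. -/
def sandwich (r s : Paths V) : KQ K V →ₗ[K] KQ K V :=
  (mulHom.flip (ofPath s)).comp (mulHom (ofPath r))

theorem sandwich_apply (r s : Paths V) (x : KQ K V) :
    sandwich r s x = ofPath r * x * ofPath s := rfl

theorem sandwich_ofPath {a b c d : V} (r : Quiver.Path a b) (p : Quiver.Path b c)
    (s : Quiver.Path c d) :
    sandwich ⟨a, b, r⟩ ⟨c, d, s⟩ (ofPath ⟨b, c, p⟩ : KQ K V) =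
      ofPath ⟨a, d, r.comp (p.comp s)⟩ := by
  rw [sandwich_apply, ofPath_mul_comp, ofPath_mul_comp, Quiver.Path.comp_assoc]

theorem sandwich_ofPath_of_ne {r s p : Paths V} (h : ¬ (p.1 = r.2.1 ∧ p.2.1 = s.1)) :
    sandwich r s (ofPath p : KQ K V) = 0 := by
  obtain ⟨a, b, r⟩ := r
  obtain ⟨c, d, s⟩ := s
  obtain ⟨e, f, p⟩ := p
  rw [sandwich_apply]
  by_cases h1 : e = b
  · subst h1
    by_cases h2 : f = c
    · exact absurd ⟨rfl, h2⟩ h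
    · rw [ofPath_mul_comp, ofPath_mul_of_ne _ _ (Ne.symm h2)]
  · rw [ofPath_mul_of_ne _ _ h1, zero_mul']

/-- Multiplying by the trivial paths at the two ends of t kills exactly the paths not parallel to t.
Hence every two-sided ideal is stable under this projection. -/
theorem restrict_parallel (t : Paths V) (x : KQ K V) :
    restrict {p | Parallel p t} x =
      sandwich ⟨t.1, t.1, Quiver.Path.nil⟩ ⟨t.2.1, t.2.1, Quiver.Path.nil⟩ x := by
  refine LinearMap.congr_fun (linearMap_ext fun p => ?_) x
  by_cases h : Parallel p t
  · rw [restrict_ofPath_of_mem (s := {p | Parallel p t}) h]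
    obtain ⟨a, b, p⟩ := p
    obtain ⟨a', b', t⟩ := t
    obtain ⟨h1, h2⟩ := h
    dsimp only at h1 h2
    subst h1 h2
    rw [sandwich_ofPath, Quiver.Path.nil_comp, Quiver.Path.comp_nil]
  · rw [restrict_ofPath_of_notMem (s := {p | Parallel p t}) h]
    exact (sandwich_ofPath_of_ne (r := ⟨t.1, t.1, Quiver.Path.nil⟩)
      (s := ⟨t.2.1, t.2.1, Quiver.Path.nil⟩) h).symm

variable [Fintype V]

/-- The subspace underlying a two-sided ideal. -/
def idealSubmodule (I : TwoSidedIdeal (KQ K V)) : Submodule K (KQ K V) where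
  carrier := {x | x ∈ I}
  zero_mem' := I.zero_mem
  add_mem' := I.add_mem
  smul_mem' c x hx := by
    have h : c • x = (c • (1 : KQ K V)) * x := by rw [smul_mul', one_mul']
    change c • x ∈ I
    rw [h]
    exact I.mul_mem_left _ _ hx

theorem sandwich_mem {I : TwoSidedIdeal (KQ K V)} {x : KQ K V} (hx : x ∈ I) (r s : Paths V) :
    sandwich r s x ∈ I := by
  rw [sandwich_apply]
  exact I.mul_mem_right _ _ (I.mul_mem_left _ _ hx)

theorem mul_mul_mem_of_sandwich_mem {M : Submodule K (KQ K V)} {x : KQ K V}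
    (hx : ∀ r s, sandwich r s x ∈ M) (y z : KQ K V) : y * x * z ∈ M := by
  induction y using induction_on with
  | h0 => rw [zero_mul', zero_mul']; exact zero_mem _
  | hadd y y' h h' => rw [add_mul', add_mul']; exact add_mem h h'
  | hs c p =>
    induction z using induction_on with
    | h0 => rw [mul_zero']; exact zero_mem _
    | hadd y y' h h' => rw [mul_add']; exact add_mem h h'
    | hs d q =>
      rw [smul_mul', smul_mul', mul_smul']
      exact M.smul_mem _ (M.smul_mem _ (hx p q))

/-- The largest two-sided ideal contained in a subspace. -/
def largestIdeal (M : Submodule K (KQ K V)) : TwoSidedIdeal (KQ K V) :=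
  TwoSidedIdeal.mk' {x | ∀ y z : KQ K V, y * x * z ∈ M}
    (fun y z => by rw [mul_zero', zero_mul']; exact zero_mem M)
    (fun {a b} ha hb y z => by rw [mul_add', add_mul']; exact add_mem (ha y z) (hb y z))
    (fun {a} ha y z => by rw [mul_neg, neg_mul]; exact neg_mem (ha y z))
    (fun {a b} hb y z => by rw [← mul_assoc']; exact hb (y * a) z)
    (fun {a b} ha y z => by rw [← mul_assoc', mul_assoc']; exact ha y (b * z))

theorem mem_largestIdeal {M : Submodule K (KQ K V)} {x : KQ K V} :
    x ∈ largestIdeal M ↔ ∀ y z : KQ K V, y * x * z ∈ M :=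
  TwoSidedIdeal.mem_mk' _ _ _ _ _ _ _

/-- The ideal generated by `S` is spanned by the elements `r y s` with `y ∈ S` and paths
`r` and `s`. -/
theorem mem_of_mem_span {S : Set (KQ K V)} {M : Submodule K (KQ K V)}
    (hS : ∀ y ∈ S, ∀ r s, sandwich r s y ∈ M) {x : KQ K V}
    (hx : x ∈ TwoSidedIdeal.span S) : x ∈ M := by
  -- By bilinearity the hypothesis places the generators in an ideal contained in M; multiplying by
  -- 1 on both sides then returns x itself.
  have h : TwoSidedIdeal.span S ≤ largestIdeal M :=
    TwoSidedIdeal.span_le.2 fun y hy =>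
      mem_largestIdeal.2 (mul_mul_mem_of_sandwich_mem (hS y hy))
  have h1 := mem_largestIdeal.1 (h hx) 1 1
  rwa [one_mul', mul_one'] at h1

end Sandwich

/-! ### Subpaths and weights -/

section Subpaths

variable {V : Type u} [Quiver.{v} V]

theorem isSubpath_refl (p : Paths V) : IsSubpath p p :=
  ⟨Quiver.Path.nil, Quiver.Path.nil, by rw [Quiver.Path.nil_comp, Quiver.Path.comp_nil]⟩

theorem IsSubpath.trans {p q r : Paths V} (hpq : IsSubpath p q) (hqr : IsSubpath q r) :
    IsSubpath p r := by
  obtain ⟨a, b, h⟩ := hpq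
  obtain ⟨c, d, h'⟩ := hqr
  refine ⟨c.comp a, b.comp d, ?_⟩
  rw [h', h]
  simp only [Quiver.Path.comp_assoc]

theorem isSubpath_comp {a b c d : V} (r : Quiver.Path a b) (p : Quiver.Path b c)
    (s : Quiver.Path c d) : IsSubpath ⟨b, c, p⟩ ⟨a, d, r.comp (p.comp s)⟩ :=
  ⟨r, s, rfl⟩

theorem notMem_nontips {T : Set (Paths V)} {p : Paths V} :
    p ∉ nontips T ↔ ∃ t ∈ T, IsSubpath t p := by
  simp only [nontips, Set.mem_ofPred_eq, not_forall, not_not, exists_prop]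

theorem notMem_nontips_of_mem {T : Set (Paths V)} {t : Paths V} (ht : t ∈ T) : t ∉ nontips T :=
  notMem_nontips.2 ⟨t, ht, isSubpath_refl t⟩

theorem weight_comp_comp {G : Type*} [Group G] (W : ∀ {a b : V}, (a ⟶ b) → G) {a b c d : V}
    (r : Quiver.Path a b) (p : Quiver.Path b c) (s : Quiver.Path c d) :
    weight W ⟨a, d, r.comp (p.comp s)⟩ =
      weight W ⟨a, b, r⟩ * (weight W ⟨b, c, p⟩ * weight W ⟨c, d, s⟩) := by
  simp only [weight, Quiver.Path.weight_comp]

end Subpaths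

/-! ### Admissible orders and normal forms -/

section Order

variable {V : Type u} [Quiver.{v} V] {lt : Paths V → Paths V → Prop}

theorem IsAdmissibleOrder.wf (hlt : IsAdmissibleOrder lt) : WellFounded lt :=
  haveI := hlt.isWellOrder
  IsWellFounded.wf

theorem IsAdmissibleOrder.trans (hlt : IsAdmissibleOrder lt) {p q r : Paths V} (h : lt p q)
    (h' : lt q r) : lt p r :=
  haveI := hlt.isWellOrder
  _root_.trans h h'

theorem IsAdmissibleOrder.ne (hlt : IsAdmissibleOrder lt) {p q : Paths V} (h : lt p q) : p ≠ q := by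
  rintro rfl
  exact hlt.wf.irrefl.irrefl p h

theorem IsAdmissibleOrder.sandwich (hlt : IsAdmissibleOrder lt) {a b c d : V}
    (r : Quiver.Path a b) {p q : Quiver.Path b c} (s : Quiver.Path c d)
    (h : lt ⟨b, c, q⟩ ⟨b, c, p⟩) :
    lt ⟨a, d, r.comp (q.comp s)⟩ ⟨a, d, r.comp (p.comp s)⟩ :=
  hlt.mul_left _ _ r (hlt.mul_right _ _ s h)

variable {K : Type w} [Field K]

/-- Paths in x need not be parallel to p. Those that do not compose with r and s become 0, and the
others stay below r p s by admissibility. -/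
theorem IsAdmissibleOrder.sandwich_mem_pathSpan (hlt : IsAdmissibleOrder lt) {a b c d : V}
    (r : Quiver.Path a b) {p : Quiver.Path b c} (s : Quiver.Path c d) {x : KQ K V}
    (hx : x ∈ pathSpan K {q | lt q ⟨b, c, p⟩}) :
    PathAlg.sandwich ⟨a, b, r⟩ ⟨c, d, s⟩ x ∈
      pathSpan K {q | lt q ⟨a, d, r.comp (p.comp s)⟩} := by
  refine (pathSpan_le.2 ?_ : _ ≤ (pathSpan K {q | lt q ⟨a, d, r.comp (p.comp s)⟩}).comap
    (PathAlg.sandwich ⟨a, b, r⟩ ⟨c, d, s⟩)) hx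
  rintro ⟨b', c', q⟩ hq
  rw [Submodule.mem_comap]
  by_cases h : b' = b ∧ c' = c
  · obtain ⟨rfl, rfl⟩ := h
    rw [sandwich_ofPath]
    exact ofPath_mem_pathSpan (hlt.sandwich r s hq)
  · rw [sandwich_ofPath_of_ne h]
    exact zero_mem _

theorem IsAdmissibleOrder.exists_isTip (hlt : IsAdmissibleOrder lt) {x : KQ K V} (hx : x ≠ 0) :
    ∃ p, IsTip lt x p := by
  classical
  have := hlt.isWellOrder
  let := linearOrderOfSTO lt
  have hne : (x : Paths V →₀ K).support.Nonempty := Finsupp.support_nonempty_iff.2 hx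
  obtain ⟨p, hp, hmax⟩ := Finset.exists_max_image _ id hne
  -- In `linearOrderOfSTO` the relation q ≤ p unfolds to q = p ∨ lt q p, the shape required by
  -- `IsTip`.
  exact ⟨p, Finsupp.mem_support_iff.1 hp, fun q hq => hmax q (Finsupp.mem_support_iff.2 hq)⟩

theorem IsAdmissibleOrder.exists_normalForm (hlt : IsAdmissibleOrder lt) {U : Set (Paths V)}
    {J : Submodule K (KQ K V)}
    (hU : ∀ p ∈ U, ∃ h ∈ pathSpan K {q | lt q p}, ofPath p - h ∈ J) (p : Paths V) :
    (ofPath p : KQ K V) ∈ pathSpan K (Uᶜ ∩ {q | q = p ∨ lt q p}) ⊔ J := by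
  have h := single_mem_supported_sup (R := K) hlt.wf hlt.trans U J
    (fun p hp => by
      obtain ⟨h, hh, hJ⟩ := hU p hp
      exact ⟨h, (pathSpan_eq_supported (K := K) {q | lt q p}).le hh, hJ⟩) p
  rw [← pathSpan_eq_supported] at h
  exact h

/-- Reduction never produces bigger paths, so the strict bound by p survives. This bound is what
later puts the remainder of t into the span of 𝒩(t). -/
theorem IsAdmissibleOrder.exists_normalForm_lt (hlt : IsAdmissibleOrder lt) {U : Set (Paths V)}
    {J : Submodule K (KQ K V)}
    (hU : ∀ p ∈ U, ∃ h ∈ pathSpan K {q | lt q p}, ofPath p - h ∈ J) {p : Paths V} {x : KQ K V}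
    (hx : x ∈ pathSpan K {q | lt q p}) :
    ∃ y ∈ pathSpan K (Uᶜ ∩ {q | lt q p}), x - y ∈ J := by
  have h : x ∈ pathSpan K (Uᶜ ∩ {q | lt q p}) ⊔ J := by
    refine (pathSpan_le.2 fun q hq => ?_ : pathSpan K {q | lt q p} ≤ _) hx
    have hle : pathSpan K (Uᶜ ∩ {r | r = q ∨ lt r q}) ≤ pathSpan K (Uᶜ ∩ {q | lt q p}) := by
      refine pathSpan_mono ?_
      rintro r ⟨hr, rfl | hr'⟩
      · exact ⟨hr, hq⟩
      · exact ⟨hr, hlt.trans hr' hq⟩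
    exact sup_le_sup_right hle _ (hlt.exists_normalForm hU q)
  obtain ⟨y, hy, z, hz, rfl⟩ := Submodule.mem_sup.1 h
  exact ⟨y, hy, by rwa [add_sub_cancel_left]⟩

theorem IsAdmissibleOrder.exists_mem_pathSpan_sub_mem (hlt : IsAdmissibleOrder lt)
    {U : Set (Paths V)} {J : Submodule K (KQ K V)}
    (hU : ∀ p ∈ U, ∃ h ∈ pathSpan K {q | lt q p}, ofPath p - h ∈ J) (x : KQ K V) :
    ∃ y ∈ pathSpan K Uᶜ, x - y ∈ J := by
  have h : x ∈ pathSpan K Uᶜ ⊔ J := by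
    refine (pathSpan_le.2 fun q _ => ?_ : pathSpan K Set.univ ≤ _) (mem_pathSpan_univ x)
    have hle : pathSpan K (Uᶜ ∩ {r | r = q ∨ lt r q}) ≤ pathSpan K Uᶜ :=
      pathSpan_mono Set.inter_subset_left
    exact sup_le_sup_right hle _ (hlt.exists_normalForm hU q)
  obtain ⟨y, hy, z, hz, rfl⟩ := Submodule.mem_sup.1 h
  exact ⟨y, hy, by rwa [add_sub_cancel_left]⟩

end Order

/-! ### Tips of ideals and monomial ideals -/

section Tips

variable {K : Type w} {V : Type u} [Quiver.{v} V] [Field K] [Fintype V]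
  {lt : Paths V → Paths V → Prop}

/-- Dividing by the leading coefficient turns an element with tip p into a rewriting rule p → h, the
form consumed by the normal form lemmas. -/
theorem mem_tips_iff (hlt : IsAdmissibleOrder lt) {I : TwoSidedIdeal (KQ K V)} {p : Paths V} :
    p ∈ tips lt {x | x ∈ I} ↔
      ∃ h ∈ pathSpan K {q | lt q p}, ofPath p - h ∈ idealSubmodule I := by
  constructor
  · rintro ⟨x, hx, -, hp, hmax⟩
    refine ⟨ofPath p - (coeff x p)⁻¹ • x, mem_pathSpan.2 fun q hq => ?_, ?_⟩
    · rw [coeff_sub, coeff_smul] at hq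
      by_cases hqp : q = p
      · subst hqp
        rw [coeff_ofPath_self, inv_mul_cancel₀ hp, sub_self] at hq
        exact absurd rfl hq
      · refine (hmax q fun h => hq ?_).resolve_left hqp
        rw [coeff_ofPath_of_ne hqp, h, mul_zero, sub_zero]
    · rw [sub_sub_cancel]
      exact (idealSubmodule I).smul_mem _ hx
  · rintro ⟨h, hh, hI⟩
    have hp : coeff (ofPath p - h) p = 1 := by
      rw [coeff_sub, coeff_ofPath_self, coeff_eq_zero_of_mem_pathSpan hh
        (fun h' => hlt.ne h' rfl), sub_zero]
    have hp0 : coeff (ofPath p - h) p ≠ 0 := by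
      rw [hp]
      exact one_ne_zero
    refine ⟨_, hI, fun h0 => hp0 (by rw [h0, coeff_zero]), hp0, fun q hq => ?_⟩
    by_cases hqp : q = p
    · exact Or.inl hqp
    · rw [coeff_sub, coeff_ofPath_of_ne hqp, zero_sub, neg_ne_zero] at hq
      exact Or.inr (mem_pathSpan.1 hh q hq)

theorem tips_of_isSubpath (hlt : IsAdmissibleOrder lt) {I : TwoSidedIdeal (KQ K V)}
    {p q : Paths V} (hp : p ∈ tips lt {x | x ∈ I}) (hpq : IsSubpath p q) :
    q ∈ tips lt {x | x ∈ I} := by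
  obtain ⟨h, hh, hI⟩ := (mem_tips_iff hlt).1 hp
  obtain ⟨b, c, p⟩ := p
  obtain ⟨a, d, q⟩ := q
  obtain ⟨r, s, hq⟩ := hpq
  dsimp only at r s hq
  subst hq
  refine (mem_tips_iff hlt).2
    ⟨sandwich ⟨a, b, r⟩ ⟨c, d, s⟩ h, hlt.sandwich_mem_pathSpan r s hh, ?_⟩
  rw [← sandwich_ofPath, ← map_sub]
  exact sandwich_mem hI _ _

theorem nontips_tips (hlt : IsAdmissibleOrder lt) (I : TwoSidedIdeal (KQ K V)) :
    nontips (tips lt {x | x ∈ I}) = (tips lt {x | x ∈ I})ᶜ := by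
  ext p
  rw [← not_iff_not, notMem_nontips, Set.notMem_compl_iff]
  exact ⟨fun ⟨t, ht, h⟩ => tips_of_isSubpath hlt ht h, fun h => ⟨p, h, isSubpath_refl p⟩⟩

/-- The span of the paths having a subpath in P already contains all r t s with t in P, so it
contains the ideal generated by P. -/
theorem ofPath_mem_monomialIdeal {P : Set (Paths V)} {p : Paths V} :
    ofPath p ∈ monomialIdeal K P ↔ p ∉ nontips P := by
  constructor
  · intro h
    refine mem_of_ofPath_mem_pathSpan (s := (nontips P)ᶜ) (K := K) (mem_of_mem_span ?_ h)
    rintro _ ⟨⟨b, c, t⟩, ht, rfl⟩ ⟨a, b', r⟩ ⟨c', d, s⟩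
    by_cases hc : b = b' ∧ c = c'
    · obtain ⟨rfl, rfl⟩ := hc
      rw [sandwich_ofPath]
      have h' := notMem_nontips.2 ⟨_, ht, isSubpath_comp r t s⟩
      exact ofPath_mem_pathSpan (s := (nontips P)ᶜ) h'
    · rw [sandwich_ofPath_of_ne hc]
      exact zero_mem _
  · intro h
    obtain ⟨⟨b, c, t⟩, ht, r, s, hp⟩ := notMem_nontips.1 h
    obtain ⟨a, d, p⟩ := p
    dsimp only at r s hp
    subst hp
    rw [← sandwich_ofPath]
    have hmem : ofPath ⟨b, c, t⟩ ∈ monomialIdeal K P := TwoSidedIdeal.subset_span ⟨_, ht, rfl⟩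
    exact sandwich_mem hmem _ _

theorem monomialIdeal_eq_iff {P P' : Set (Paths V)} :
    monomialIdeal K P = monomialIdeal K P' ↔ nontips P = nontips P' := by
  constructor
  · intro h
    ext p
    rw [← not_iff_not, ← ofPath_mem_monomialIdeal (K := K), h, ofPath_mem_monomialIdeal]
  · intro h
    refine le_antisymm (TwoSidedIdeal.span_le.2 ?_) (TwoSidedIdeal.span_le.2 ?_)
    · rintro _ ⟨p, hp, rfl⟩
      exact ofPath_mem_monomialIdeal.2 (h ▸ notMem_nontips_of_mem hp)
    · rintro _ ⟨p, hp, rfl⟩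
      exact ofPath_mem_monomialIdeal.2 (h ▸ notMem_nontips_of_mem hp)

theorem assocMonomialIdeal_eq_iff (hlt : IsAdmissibleOrder lt) {I : TwoSidedIdeal (KQ K V)}
    {T : Set (Paths V)} :
    assocMonomialIdeal lt I = monomialIdeal K T ↔ tips lt {x | x ∈ I} = (nontips T)ᶜ := by
  rw [assocMonomialIdeal, monomialIdeal_eq_iff, nontips_tips hlt, compl_eq_comm, eq_comm]

theorem eq_zero_of_mem_of_mem_pathSpan (hlt : IsAdmissibleOrder lt) {I : TwoSidedIdeal (KQ K V)}
    {x : KQ K V} (hx : x ∈ I) (hx' : x ∈ pathSpan K (tips lt {x | x ∈ I})ᶜ) : x = 0 := by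
  by_contra h0
  obtain ⟨p, hp⟩ := hlt.exists_isTip h0
  exact mem_pathSpan.1 hx' p hp.1 ⟨x, hx, h0, hp⟩

/-- If the ideal `I` contains elements with tips in `T` and no nonzero combination of paths
without subpath in `T`, then the tips of `I` are the paths with a subpath in `T`. -/
theorem tips_eq_compl_nontips (hlt : IsAdmissibleOrder lt) {I : TwoSidedIdeal (KQ K V)}
    {T : Set (Paths V)} (hT : T ⊆ tips lt {x | x ∈ I})
    (h0 : ∀ x ∈ I, x ∈ pathSpan K (nontips T) → x = 0) :
    tips lt {x | x ∈ I} = (nontips T)ᶜ := by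
  have hsub : (nontips T)ᶜ ⊆ tips lt {x | x ∈ I} := fun p hp => by
    obtain ⟨t, ht, htp⟩ := notMem_nontips.1 hp
    exact tips_of_isSubpath hlt (hT ht) htp
  refine subset_antisymm (fun p hp hpT => ?_) hsub
  obtain ⟨h, hh, hI⟩ := (mem_tips_iff hlt).1 hp
  -- For a tip p lying in 𝒩, reducing the lower part h gives p - y in I ∩ Span 𝒩, so p = y; but y
  -- involves only paths strictly below p.
  obtain ⟨y, hy, hyI⟩ := hlt.exists_normalForm_lt (U := (nontips T)ᶜ) (J := idealSubmodule I)
    (fun q hq => (mem_tips_iff hlt).1 (hsub hq)) hh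
  rw [compl_compl] at hy
  have hmem : ofPath p - y ∈ I := by
    rw [← sub_add_sub_cancel (ofPath p) h y]
    exact I.add_mem hI hyI
  have hzero := h0 _ hmem (sub_mem (ofPath_mem_pathSpan hpT)
    (pathSpan_mono Set.inter_subset_left hy))
  rw [sub_eq_zero] at hzero
  rw [← hzero] at hy
  exact hlt.ne (mem_of_ofPath_mem_pathSpan hy).2 rfl

end Tips

/-! ### Reduced Gröbner bases in terms of tips -/

section Points

variable {K : Type w} {V : Type u} [Quiver.{v} V] [Field K] [Fintype V]
  {lt : Paths V → Paths V → Prop} {T : Set (Paths V)} {M : Paths V → Set (Paths V)}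

theorem ofPath_sub_gen_mem (c : Index T M → K) (t : T) :
    ofPath t.1 - gen c t ∈ pathSpan K (M t) := by
  rw [gen, sub_sub_cancel]
  exact finsum_smul_ofPath_mem _

theorem gen_mem_idealOf (c : Index T M → K) (t : T) : gen c t ∈ idealOf c :=
  TwoSidedIdeal.subset_span ⟨t, rfl⟩

theorem subset_tips_idealOf (hlt : IsAdmissibleOrder lt) (hM : ∀ t, M t ⊆ nontipsOf T lt t)
    (c : Index T M → K) : T ⊆ tips lt {x | x ∈ idealOf c} := fun t ht =>
  (mem_tips_iff hlt).2 ⟨_, pathSpan_mono (fun _ hn => (hM t hn).2.2) (ofPath_sub_gen_mem c ⟨t, ht⟩),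
    by rw [sub_sub_cancel]; exact gen_mem_idealOf c ⟨t, ht⟩⟩

/-- The shape of the g_t already makes T consist of tips and t - g_t a combination of elements of 𝒩.
What remains is that no path in 𝒩 is a tip, together with the identification of the minimal
generating set in `IsReducedGroebnerBasis` with T. -/
theorem isReducedGroebnerBasis_iff (hlt : IsAdmissibleOrder lt) (hT : IsTipReduced T)
    (hM : ∀ t, M t ⊆ nontipsOf T lt t) (c : Index T M → K) :
    IsReducedGroebnerBasis lt (idealOf c) (Set.range (gen c)) ↔
      tips lt {x | x ∈ idealOf c} = (nontips T)ᶜ := by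
  have hlow : ∀ t : T, ofPath t.1 - gen c t ∈ pathSpan K (nontips T) := fun t =>
    pathSpan_mono (fun _ hn => (hM t hn).1) (ofPath_sub_gen_mem c t)
  have hTt := subset_tips_idealOf hlt hM c
  constructor
  · rintro ⟨T', hT', hX⟩
    have htips := (assocMonomialIdeal_eq_iff hlt).1 hT'.1.symm
    -- The coefficient of t in g_t is 1. As t is a tip, it may not occur in t' - g_t, so it has to
    -- be cancelled by t'.
    have key : ∀ (t : T) (t' : Paths V),
        ofPath t' - gen c t ∈ pathSpan K (tips lt {x | x ∈ idealOf c})ᶜ → t.1 = t' := by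
      intro t t' h
      by_contra hne
      have h1 := coeff_eq_zero_of_mem_pathSpan h (fun h' => h' (hTt t.2))
      have h2 := coeff_eq_zero_of_mem_pathSpan (hlow t) (notMem_nontips_of_mem t.2)
      rw [coeff_sub, coeff_ofPath_of_ne hne, zero_sub, neg_eq_zero] at h1
      rw [coeff_sub, h1, sub_zero, coeff_ofPath_self] at h2
      exact one_ne_zero h2
    have hTT' : T' = T := by
      refine subset_antisymm (fun t' ht' => ?_) (fun t ht => ?_)
      · obtain ⟨y, hy, hyI⟩ := hlt.exists_mem_pathSpan_sub_mem (J := idealSubmodule (idealOf c))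
          (fun q hq => (mem_tips_iff hlt).1 hq) (ofPath t')
        have hg : ofPath t' - y ∈ Set.range (gen c) := by
          rw [hX]
          refine ⟨hyI, t', ht', ?_⟩
          rw [sub_sub_cancel]
          exact hy
        obtain ⟨t, ht⟩ := hg
        rw [← key t t' (by rw [ht, sub_sub_cancel]; exact hy)]
        exact t.2
      · have hg : gen c ⟨t, ht⟩ ∈ Set.range (gen c) := ⟨_, rfl⟩
        rw [hX] at hg
        obtain ⟨-, t', ht', h⟩ := hg
        have := key ⟨t, ht⟩ t' h
        dsimp only at this
        rwa [this]
    rw [htips, hTT']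
  · intro htips
    refine ⟨T, ⟨((assocMonomialIdeal_eq_iff hlt).2 htips).symm, ?_⟩, ?_⟩
    -- A subset P of T generating the same ideal contains a subpath of each t in T; as T is reduced,
    -- this subpath is t itself.
    · intro P hP hPT t ht
      have h : nontips P = nontips T :=
        monomialIdeal_eq_iff.1 (hP.trans ((assocMonomialIdeal_eq_iff hlt).2 htips))
      have ht' : t ∉ nontips P := h ▸ notMem_nontips_of_mem ht
      obtain ⟨p, hp, hpt⟩ := notMem_nontips.1 ht'
      by_cases hne : p = t
      · exact hne ▸ hp
      · exact absurd hpt (hT p (hPT hp) t ht hne)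
    · rw [htips, compl_compl]
      ext g
      constructor
      · rintro ⟨t, rfl⟩
        exact ⟨gen_mem_idealOf c t, t.1, t.2, hlow t⟩
      · rintro ⟨hg, t, ht, hgt⟩
        refine ⟨⟨t, ht⟩, ?_⟩
        -- Two elements of the ideal with the same leading path t and lower terms in 𝒩 differ by an
        -- element of I_c ∩ Span 𝒩.
        rw [← sub_eq_zero]
        refine eq_zero_of_mem_of_mem_pathSpan hlt
          ((idealOf c).sub_mem (gen_mem_idealOf c ⟨t, ht⟩) hg) ?_
        rw [htips, compl_compl, ← sub_sub_sub_cancel_left _ _ (ofPath t)]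
        exact sub_mem hgt (hlow ⟨t, ht⟩)

theorem mem_pointsWith_iff (hlt : IsAdmissibleOrder lt) (hT : IsTipReduced T)
    (hM : ∀ t, M t ⊆ nontipsOf T lt t) (c : Index T M → K) :
    c ∈ pointsWith K T M lt ↔ (∀ t : T, {n : M t.1 | c ⟨t, n⟩ ≠ 0}.Finite) ∧
      tips lt {x | x ∈ idealOf c} = (nontips T)ᶜ :=
  and_congr_right fun _ => isReducedGroebnerBasis_iff hlt hT hM c

/-- This replaces a condition on tips by a linear one, which can be tested with a normal form map.
-/
theorem tips_idealOf_eq_iff (hlt : IsAdmissibleOrder lt)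
    (hM : ∀ t, M t ⊆ nontipsOf T lt t) (c : Index T M → K) :
    tips lt {x | x ∈ idealOf c} = (nontips T)ᶜ ↔
      ∀ x ∈ idealOf c, x ∈ pathSpan K (nontips T) → x = 0 := by
  refine ⟨fun h x hx hx' => eq_zero_of_mem_of_mem_pathSpan hlt hx ?_,
    tips_eq_compl_nontips hlt (subset_tips_idealOf hlt hM c)⟩
  rwa [h, compl_compl]

end Points

/-! ### Weight homogeneous ideals and the bijection with points -/

section WeightHomogeneous

variable {K : Type w} {V : Type u} [Quiver.{v} V] [Field K] {G : Type*} [Group G]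
  {lt : Paths V → Paths V → Prop} {T : Set (Paths V)}

theorem gradedNontipsOf_subset (W : ∀ {a b : V}, (a ⟶ b) → G) (t : Paths V) :
    gradedNontipsOf T lt W t ⊆ nontipsOf T lt t := fun _ hn => hn.1

variable [Fintype V]

theorem sandwich_mem_weightSpace (W : ∀ {a b : V}, (a ⟶ b) → G) {g : G} {x : KQ K V}
    (hx : x ∈ weightSpace K W g) (r s : Paths V) :
    sandwich r s x ∈ weightSpace K W (weight W r * (g * weight W s)) := by
  obtain ⟨a, b, r⟩ := r
  obtain ⟨c, d, s⟩ := s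
  refine (pathSpan_le.2 ?_ : pathSpan K {p | weight W p = g} ≤
    (pathSpan K {p | weight W p = _}).comap (sandwich ⟨a, b, r⟩ ⟨c, d, s⟩)) hx
  rintro ⟨b', c', p⟩ hp
  rw [Submodule.mem_comap]
  by_cases h : b' = b ∧ c' = c
  · obtain ⟨rfl, rfl⟩ := h
    rw [sandwich_ofPath]
    refine ofPath_mem_pathSpan ?_
    rw [Set.mem_ofPred_eq] at hp ⊢
    rw [weight_comp_comp, hp]
  · rw [sandwich_ofPath_of_ne h]
    exact zero_mem _

/-- The ideal is spanned by the r y s with y a homogeneous generator. Each of these is again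
homogeneous, so the projection either fixes it or kills it. -/
theorem restrict_weight_mem (W : ∀ {a b : V}, (a ⟶ b) → G) {I : TwoSidedIdeal (KQ K V)}
    (hI : IsWeightHomogeneous W I) {x : KQ K V} (hx : x ∈ I) (g : G) :
    restrict {p | weight W p = g} x ∈ I := by
  obtain ⟨S, hS, rfl⟩ := hI
  refine mem_of_mem_span
    (M := (idealSubmodule (TwoSidedIdeal.span S)).comap (restrict {p | weight W p = g})) ?_ hx
  intro y hy r s
  rw [Submodule.mem_comap]
  obtain ⟨h, hh⟩ := hS y hy
  have hw := sandwich_mem_weightSpace W hh r s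
  by_cases hg : weight W r * (h * weight W s) = g
  · rw [restrict_eq_self (hg ▸ hw)]
    have hy' : y ∈ TwoSidedIdeal.span S := TwoSidedIdeal.subset_span hy
    exact sandwich_mem hy' r s
  · have hdisj : Disjoint {p : Paths V | weight W p = weight W r * (h * weight W s)}
        {p | weight W p = g} := Set.disjoint_left.2 fun p hp hp' => hg (hp.symm.trans hp')
    rw [restrict_eq_zero hdisj hw]
    exact zero_mem _

theorem isWeightHomogeneous_idealOf (W : ∀ {a b : V}, (a ⟶ b) → G)
    (c : Index T (gradedNontipsOf T lt W) → K) : IsWeightHomogeneous W (idealOf c) := by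
  refine ⟨_, ?_, rfl⟩
  rintro _ ⟨t, rfl⟩
  refine ⟨weight W t.1, ?_⟩
  rw [← sub_sub_cancel (ofPath t.1) (gen c t)]
  have h1 : (ofPath t.1 : KQ K V) ∈ pathSpan K {p | weight W p = weight W t.1} :=
    ofPath_mem_pathSpan rfl
  exact sub_mem h1 (pathSpan_mono (fun _ hn => hn.2) (ofPath_sub_gen_mem c t))

/-- Normal forms with respect to a weight homogeneous ideal can be chosen parallel and of the same
weight. -/
theorem exists_homogeneous_normalForm (hlt : IsAdmissibleOrder lt)
    (W : ∀ {a b : V}, (a ⟶ b) → G) {I : TwoSidedIdeal (KQ K V)} (hI : IsWeightHomogeneous W I)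
    (htips : tips lt {x | x ∈ I} = (nontips T)ᶜ) {t : Paths V} (ht : t ∈ T) :
    ∃ y ∈ pathSpan K (gradedNontipsOf T lt W t), ofPath t - y ∈ I := by
  have htI : t ∈ tips lt {x | x ∈ I} := by
    rw [htips]
    exact notMem_nontips_of_mem ht
  obtain ⟨h, hh, hhI⟩ := (mem_tips_iff hlt).1 htI
  obtain ⟨y, hy, hyI⟩ := hlt.exists_normalForm_lt (J := idealSubmodule I)
    (fun q hq => (mem_tips_iff hlt).1 hq) hh
  have hmem : ofPath t - y ∈ I := by
    rw [← sub_add_sub_cancel (ofPath t) h y]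
    exact I.add_mem hhI hyI
  -- Both projections preserve I and fix t, so they may be applied to the remainder y alone.
  have hmem' : restrict {p | weight W p = weight W t} (restrict {p | Parallel p t} (ofPath t - y))
      ∈ I := by
    refine restrict_weight_mem W hI ?_ _
    rw [restrict_parallel]
    exact sandwich_mem hmem _ _
  rw [map_sub, map_sub, restrict_ofPath_of_mem (s := {p | Parallel p t}) ⟨rfl, rfl⟩,
    restrict_ofPath_of_mem (s := {p | weight W p = weight W t}) rfl] at hmem'
  refine ⟨_, pathSpan_mono ?_ (restrict_mem_pathSpan_inter (restrict_mem_pathSpan_inter hy)), hmem'⟩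
  rintro p ⟨⟨⟨hp, hpt⟩, hpar⟩, hw⟩
  rw [htips, compl_compl] at hp
  exact ⟨⟨hp, hpar, hpt⟩, hw⟩

theorem injOn_idealOf (hlt : IsAdmissibleOrder lt) (hT : IsTipReduced T)
    {M : Paths V → Set (Paths V)} (hM : ∀ t, M t ⊆ nontipsOf T lt t) :
    Set.InjOn idealOf (pointsWith K T M lt) := by
  intro c hc c' hc' h
  rw [mem_pointsWith_iff hlt hT hM] at hc hc'
  funext ⟨t, n⟩
  have hg : gen c t = gen c' t := by
    rw [← sub_eq_zero]
    refine (tips_idealOf_eq_iff hlt hM c).1 hc.2 _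
      ((idealOf c).sub_mem (gen_mem_idealOf c t) (h ▸ gen_mem_idealOf c' t)) ?_
    rw [← sub_sub_sub_cancel_left _ _ (ofPath t.1)]
    have hle : pathSpan K (M t) ≤ pathSpan K (nontips T) := pathSpan_mono fun _ hn => (hM t hn).1
    exact hle (sub_mem (ofPath_sub_gen_mem c' t) (ofPath_sub_gen_mem c t))
  rw [gen, gen, sub_right_inj] at hg
  -- Finiteness of the supports matters here: a `finsum` with infinite support is 0, and its
  -- coordinates could not be read back.
  rw [← coeff_finsum_smul_ofPath (hc.1 t) n, hg, coeff_finsum_smul_ofPath (hc'.1 t) n]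

theorem bijOn_idealOf (hlt : IsAdmissibleOrder lt) (hT : IsTipReduced T)
    (W : ∀ {a b : V}, (a ⟶ b) → G) :
    Set.BijOn idealOf (gradedVariety K T lt W) (gradedIdeals K T lt W) := by
  have hM : ∀ t, gradedNontipsOf T lt W t ⊆ nontipsOf T lt t := gradedNontipsOf_subset W
  refine ⟨fun c hc => ⟨isWeightHomogeneous_idealOf W c, ?_⟩, injOn_idealOf hlt hT hM, ?_⟩
  · exact (assocMonomialIdeal_eq_iff hlt).2 ((mem_pointsWith_iff hlt hT hM c).1 hc).2
  · rintro I ⟨hI, hMon⟩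
    have htips := (assocMonomialIdeal_eq_iff hlt).1 hMon
    choose y hy hyI using fun t : T => exists_homogeneous_normalForm hlt W hI htips t.2
    let c : Index T (gradedNontipsOf T lt W) → K := fun i => coeff (y i.1) i.2.1
    have hgen : ∀ t, gen c t = ofPath t.1 - y t := fun t => by
      rw [gen, finsum_coeff_smul_ofPath (hy t)]
    have hle : idealOf c ≤ I := by
      refine TwoSidedIdeal.span_le.2 ?_
      rintro _ ⟨t, rfl⟩
      rw [hgen]
      exact hyI t
    -- The remainder z of x in I upon division by the g_t lies in I as well, and contains no tip of
    -- I, so it vanishes.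
    have hge : I ≤ idealOf c := by
      intro x hx
      obtain ⟨z, hz, hzI⟩ := hlt.exists_mem_pathSpan_sub_mem (U := (nontips T)ᶜ)
        (J := idealSubmodule (idealOf c)) (fun p hp => by
          obtain ⟨t, ht, htp⟩ := notMem_nontips.1 hp
          exact (mem_tips_iff hlt).1
            (tips_of_isSubpath hlt (subset_tips_idealOf hlt hM c ht) htp)) x
      have hz0 : z = 0 := by
        refine eq_zero_of_mem_of_mem_pathSpan hlt (I := I) ?_ (htips ▸ hz)
        rw [← sub_sub_cancel x z]
        exact I.sub_mem hx (hle hzI)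
      rw [hz0, sub_zero] at hzI
      exact hzI
    have heq : idealOf c = I := le_antisymm hle hge
    refine ⟨c, (mem_pointsWith_iff hlt hT hM c).2 ⟨fun t => finite_coeff_ne_zero (y t), ?_⟩, heq⟩
    rw [heq, htips]

end WeightHomogeneous

/-! ### Extension by zero as an isomorphism -/

section ExtendZero

variable {K : Type w} {V : Type u} [Quiver.{v} V] [Field K]
  {T : Set (Paths V)} {M N : Paths V → Set (Paths V)}

open Classical in
/-- Extension by zero from the coordinates indexed by `M` to those indexed by `N`. -/
def extendZero (N : Paths V → Set (Paths V)) (c : Index T M → K) : Index T N → K := fun i =>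
  if h : i.2.1 ∈ M i.1.1 then c ⟨i.1, ⟨i.2.1, h⟩⟩ else 0

theorem extendZero_of_mem (c : Index T M → K) (t : T) (n : N t.1) (h : n.1 ∈ M t.1) :
    extendZero N c ⟨t, n⟩ = c ⟨t, ⟨n.1, h⟩⟩ := dif_pos h

theorem extendZero_of_notMem (c : Index T M → K) (t : T) (n : N t.1) (h : n.1 ∉ M t.1) :
    extendZero N c ⟨t, n⟩ = 0 := dif_neg h

theorem finite_extendZero_iff (hMN : ∀ t, M t ⊆ N t) (c : Index T M → K) (t : T) :
    {n : N t.1 | extendZero N c ⟨t, n⟩ ≠ 0}.Finite ↔ {n : M t.1 | c ⟨t, n⟩ ≠ 0}.Finite := by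
  have h : {n : N t.1 | extendZero N c ⟨t, n⟩ ≠ 0} =
      Set.inclusion (hMN t.1) '' {n : M t.1 | c ⟨t, n⟩ ≠ 0} := by
    ext n
    constructor
    · intro hn
      by_cases hnM : n.1 ∈ M t.1
      · rw [Set.mem_ofPred_eq, extendZero_of_mem c t n hnM] at hn
        exact ⟨⟨n.1, hnM⟩, hn, rfl⟩
      · exact absurd (extendZero_of_notMem c t n hnM) hn
    · rintro ⟨m, hm, rfl⟩
      rw [Set.mem_ofPred_eq, extendZero_of_mem c t (Set.inclusion (hMN t.1) m) m.2]
      exact hm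
  rw [h, Set.finite_image_iff (Set.inclusion_injective _).injOn]

theorem gen_extendZero (hMN : ∀ t, M t ⊆ N t) {c : Index T M → K} {t : T}
    (hc : {n : M t.1 | c ⟨t, n⟩ ≠ 0}.Finite) : gen (extendZero N c) t = gen c t := by
  rw [gen, gen, sub_right_inj]
  have hc' := (finite_extendZero_iff hMN c t).2 hc
  refine eq_of_coeff_eq_of_mem_pathSpan (finsum_smul_ofPath_mem _)
    (pathSpan_mono (hMN t.1) (finsum_smul_ofPath_mem _)) fun p hp => ?_
  rw [coeff_finsum_smul_ofPath hc' ⟨p, hp⟩]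
  by_cases hpM : p ∈ M t.1
  · rw [coeff_finsum_smul_ofPath hc ⟨p, hpM⟩, extendZero_of_mem c t ⟨p, hp⟩ hpM]
  · rw [coeff_eq_zero_of_mem_pathSpan (finsum_smul_ofPath_mem _) hpM,
      extendZero_of_notMem c t ⟨p, hp⟩ hpM]

variable [Fintype V] {lt : Paths V → Paths V → Prop}

/-- Zero coefficients do not alter the g_t, so both points define the same ideal with the same
candidate basis. The finiteness conditions are matched first because the comparison of the `finsum`s
needs them. -/
theorem extendZero_mem_pointsWith_iff (hMN : ∀ t, M t ⊆ N t) (c : Index T M → K) :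
    extendZero N c ∈ pointsWith K T N lt ↔ c ∈ pointsWith K T M lt := by
  have hfin := forall_congr' (finite_extendZero_iff hMN c)
  rw [pointsWith, pointsWith, Set.mem_ofPred_eq, Set.mem_ofPred_eq, hfin]
  refine and_congr_right fun hc => ?_
  have hgen : gen (extendZero N c) = gen c := funext fun t => gen_extendZero hMN (hc t)
  rw [idealOf, idealOf, hgen]

/-- Extension by zero as a bijection onto the points whose coordinates outside `M` vanish. -/
def extendZeroEquiv (hMN : ∀ t, M t ⊆ N t) (X : Set (Index T N → K))
    (hX : ∀ c, c ∈ X ↔ c ∈ pointsWith K T N lt ∧ ∀ t n, n.1 ∉ M t.1 → c ⟨t, n⟩ = 0) :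
    pointsWith K T M lt ≃ X :=
  have hinv : ∀ c ∈ X, extendZero N
      (fun i : Index T M => c ⟨i.1, ⟨i.2.1, hMN i.1.1 i.2.2⟩⟩) = c := fun c hc => by
    funext ⟨t, n⟩
    by_cases hn : n.1 ∈ M t.1
    · exact extendZero_of_mem _ t n hn
    · rw [extendZero_of_notMem _ t n hn, ((hX c).1 hc).2 t n hn]
  { toFun := fun c => ⟨extendZero N c.1, (hX _).2
      ⟨(extendZero_mem_pointsWith_iff hMN c.1).2 c.2, extendZero_of_notMem c.1⟩⟩
    invFun := fun c => ⟨fun i => c.1 ⟨i.1, ⟨i.2.1, hMN i.1.1 i.2.2⟩⟩,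
      (extendZero_mem_pointsWith_iff hMN _).1 (by
        rw [hinv c.1 c.2]
        exact ((hX c.1).1 c.2).1)⟩
    left_inv := fun c => Subtype.ext <| funext fun i =>
      extendZero_of_mem c.1 i.1 ⟨i.2.1, hMN i.1.1 i.2.2⟩ i.2.2
    right_inv := fun c => Subtype.ext (hinv c.1 c.2) }

theorem isMorphism_extendZeroEquiv (hMN : ∀ t, M t ⊆ N t) (X : Set (Index T N → K))
    (hX : ∀ c, c ∈ X ↔ c ∈ pointsWith K T N lt ∧ ∀ t n, n.1 ∉ M t.1 → c ⟨t, n⟩ = 0) :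
    IsMorphism (extendZeroEquiv hMN X hX) := by
  classical
  refine ⟨fun i => if h : i.2.1 ∈ M i.1.1 then MvPolynomial.X ⟨i.1, ⟨i.2.1, h⟩⟩ else 0,
    fun c ⟨t, n⟩ => ?_⟩
  change extendZero N c.1 ⟨t, n⟩ = MvPolynomial.eval c.1
    (if h : n.1 ∈ M t.1 then MvPolynomial.X ⟨t, ⟨n.1, h⟩⟩ else 0)
  by_cases hn : n.1 ∈ M t.1
  · rw [extendZero_of_mem c.1 t n hn, dif_pos hn, MvPolynomial.eval_X]
  · rw [extendZero_of_notMem c.1 t n hn, dif_neg hn, map_zero]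

theorem isMorphism_extendZeroEquiv_symm (hMN : ∀ t, M t ⊆ N t) (X : Set (Index T N → K))
    (hX : ∀ c, c ∈ X ↔ c ∈ pointsWith K T N lt ∧ ∀ t n, n.1 ∉ M t.1 → c ⟨t, n⟩ = 0) :
    IsMorphism (extendZeroEquiv hMN X hX).symm := by
  refine ⟨fun i => MvPolynomial.X ⟨i.1, ⟨i.2.1, hMN i.1.1 i.2.2⟩⟩, fun c i => ?_⟩
  rw [MvPolynomial.eval_X]
  rfl

end ExtendZero

/-! ### Zero sets of polynomials -/

section AffineVarieties

variable {K : Type w} [Field K] {σ : Type*}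

theorem isAffineVariety_iff {X : Set (σ → K)} :
    IsAffineVariety X ↔
      ∃ P : Set (MvPolynomial σ K), ∀ x, x ∈ X ↔ ∀ p ∈ P, MvPolynomial.eval x p = 0 := by
  constructor
  · rintro ⟨I, rfl⟩
    refine ⟨I, fun x => ?_⟩
    simp only [MvPolynomial.mem_zeroLocus_iff, MvPolynomial.aeval_eq_eval, SetLike.mem_coe]
  · rintro ⟨P, hP⟩
    refine ⟨Ideal.span P, ?_⟩
    ext x
    simp only [hP, MvPolynomial.zeroLocus_span, Set.mem_ofPred_eq, MvPolynomial.aeval_eq_eval]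

theorem IsAffineVariety.inter {X Y : Set (σ → K)} (hX : IsAffineVariety X)
    (hY : IsAffineVariety Y) : IsAffineVariety (X ∩ Y) := by
  rw [isAffineVariety_iff] at *
  obtain ⟨P, hP⟩ := hX
  obtain ⟨Q, hQ⟩ := hY
  refine ⟨P ∪ Q, fun x => ?_⟩
  rw [Set.mem_inter_iff, hP, hQ]
  simp only [Set.mem_union, or_imp, forall_and]

theorem isAffineVariety_coordinates (A : Set σ) (a : A → K) :
    IsAffineVariety {x : σ → K | ∀ i : A, x i.1 = a i} := by
  refine isAffineVariety_iff.2
    ⟨Set.range fun i : A => MvPolynomial.X i.1 - MvPolynomial.C (a i), fun x => ?_⟩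
  simp only [Set.mem_ofPred_eq, Set.forall_mem_range, map_sub, MvPolynomial.eval_X,
    MvPolynomial.eval_C, sub_eq_zero]

end AffineVarieties

/-! ### Combinations of paths with polynomial coefficients -/

section Specialize

variable {K : Type w} {V : Type u} [Quiver.{v} V] [Field K] {σ : Type*}

/-- Evaluation of the coefficients of a combination of paths with polynomial coefficients. -/
def specialize (c : σ → K) : (Paths V →₀ MvPolynomial σ K) →+ KQ K V :=
  (Finsupp.mapRange.addMonoidHom (MvPolynomial.eval c).toAddMonoidHom :
    (Paths V →₀ MvPolynomial σ K) →+ (Paths V →₀ K))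

theorem coeff_specialize (c : σ → K) (F : Paths V →₀ MvPolynomial σ K) (p : Paths V) :
    coeff (specialize c F) p = MvPolynomial.eval c (F p) := rfl

theorem specialize_single_one (c : σ → K) (p : Paths V) :
    specialize c (Finsupp.single p 1) = (ofPath p : KQ K V) := by
  refine ext_coeff fun q => ?_
  rw [coeff_specialize]
  by_cases h : q = p
  · rw [h, Finsupp.single_eq_same, coeff_ofPath_self, map_one]
  · rw [Finsupp.single_eq_of_ne h, coeff_ofPath_of_ne h, map_zero]

theorem specialize_smul (c : σ → K) (a : MvPolynomial σ K) (F : Paths V →₀ MvPolynomial σ K) :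
    specialize c (a • F) = MvPolynomial.eval c a • specialize c F := by
  refine ext_coeff fun q => ?_
  rw [coeff_smul, coeff_specialize, coeff_specialize, Finsupp.smul_apply, smul_eq_mul, map_mul]

theorem specialize_mem_pathSpan (c : σ → K) {F : Paths V →₀ MvPolynomial σ K} {s : Set (Paths V)}
    (hF : F ∈ Finsupp.supported (MvPolynomial σ K) (MvPolynomial σ K) s) :
    specialize c F ∈ pathSpan K s := by
  refine mem_pathSpan.2 fun p hp => (Finsupp.mem_supported _ _).1 hF ?_
  refine Finsupp.mem_support_iff.2 fun h => hp ?_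
  rw [coeff_specialize, h, map_zero]

theorem specialize_linearCombination (c : σ → K) (F : Paths V → (Paths V →₀ MvPolynomial σ K))
    (E : Paths V →₀ MvPolynomial σ K) :
    specialize c (Finsupp.linearCombination (MvPolynomial σ K) F E) =
      lift (fun p => specialize c (F p)) (specialize c E) := by
  induction E using Finsupp.induction_linear with
  | zero => simp only [map_zero]
  | add E E' h h' => simp only [map_add, h, h']
  | single p a =>
    have h : Finsupp.single p a = a • Finsupp.single p (1 : MvPolynomial σ K) := by
      rw [Finsupp.smul_single, smul_eq_mul, mul_one]
    rw [Finsupp.linearCombination_single, h, specialize_smul, specialize_smul,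
      specialize_single_one, LinearMap.map_smul, lift_ofPath]

end Specialize

/-! ### Universal division and the defining equations -/

section Equations

variable {K : Type w} {V : Type u} [Quiver.{v} V] [Field K]
  {lt : Paths V → Paths V → Prop} {T : Set (Paths V)} {M : Paths V → Set (Paths V)}

theorem gen_eq_sub_sum (t : T) [Fintype (M t.1)] (c : Index T M → K) :
    gen c t = ofPath t.1 - ∑ n : M t.1, c ⟨t, n⟩ • ofPath n.1 := by
  rw [gen, finsum_eq_sum_of_fintype]

theorem exists_specialize_eq_sandwich_gen (hfin : ∀ t : T, (M t.1).Finite) (r s : Paths V) (t : T) :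
    ∃ E : Paths V →₀ MvPolynomial (Index T M) K,
      ∀ c : Index T M → K, specialize c E = sandwich r s (gen c t) := by
  have hpath : ∀ p : Paths V, ∃ E : Paths V →₀ MvPolynomial (Index T M) K,
      ∀ c : Index T M → K, specialize c E = sandwich r s (ofPath p) := by
    rintro ⟨b, c, p⟩
    obtain ⟨a, b', r⟩ := r
    obtain ⟨c', d, s⟩ := s
    by_cases h : b = b' ∧ c = c'
    · obtain ⟨rfl, rfl⟩ := h
      refine ⟨Finsupp.single ⟨a, d, r.comp (p.comp s)⟩ 1, fun c => ?_⟩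
      rw [specialize_single_one, sandwich_ofPath]
    · refine ⟨0, fun c => ?_⟩
      rw [sandwich_ofPath_of_ne h, map_zero]
  choose E hE using hpath
  have := (hfin t).fintype
  refine ⟨E t.1 - ∑ n : M t.1, (MvPolynomial.X ⟨t, n⟩ : MvPolynomial (Index T M) K) • E n.1,
    fun c => ?_⟩
  simp only [gen_eq_sub_sum, map_sub, map_sum, specialize_smul, map_smul, hE, MvPolynomial.eval_X]

variable [Fintype V]

/-- The combinations of paths with polynomial coefficients whose values at every point `c` belong
to the ideal attached to `c`. -/
def universalIdeal (T : Set (Paths V)) (M : Paths V → Set (Paths V)) :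
    Submodule (MvPolynomial (Index T M) K) (Paths V →₀ MvPolynomial (Index T M) K) where
  carrier := {F | ∀ c : Index T M → K, specialize c F ∈ idealSubmodule (idealOf c)}
  zero_mem' c := by
    rw [map_zero]
    exact zero_mem _
  add_mem' hF hF' c := by
    rw [map_add]
    exact add_mem (hF c) (hF' c)
  smul_mem' a F hF c := by
    rw [specialize_smul]
    exact Submodule.smul_mem _ _ (hF c)

theorem mem_universalIdeal {F : Paths V →₀ MvPolynomial (Index T M) K} :
    F ∈ universalIdeal T M ↔ ∀ c : Index T M → K, specialize c F ∈ idealSubmodule (idealOf c) :=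
  Iff.rfl

/-- This is the rewriting rule r t s → ∑ X_{t,n} r n s with generic coefficients. The leading
coefficient is 1, so iterating it never divides and the coefficients remain polynomials. -/
theorem exists_lower_sub_mem_universalIdeal (hlt : IsAdmissibleOrder lt)
    (hM : ∀ t, M t ⊆ nontipsOf T lt t) (hfin : ∀ t : T, (M t.1).Finite) {p : Paths V}
    (hp : p ∉ nontips T) :
    ∃ h ∈ Finsupp.supported (MvPolynomial (Index T M) K) (MvPolynomial (Index T M) K) {q | lt q p},
      Finsupp.single p 1 - h ∈ universalIdeal T M := by
  obtain ⟨t, ht, hsub⟩ := notMem_nontips.1 hp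
  -- Each n in M(t) is parallel to t, so the paths r and s surrounding t in p compose with n too,
  -- and r n s is a path below p.
  obtain ⟨r, s, hrs⟩ : ∃ r s : Paths V, (sandwich r s (ofPath t) : KQ K V) = ofPath p ∧
      ∀ n ∈ M t, ∃ m, (sandwich r s (ofPath n) : KQ K V) = ofPath m ∧ lt m p := by
    obtain ⟨a, d, p⟩ := p
    obtain ⟨b, c, q⟩ := t
    obtain ⟨r, s, h⟩ := hsub
    dsimp only at r s h
    subst h
    refine ⟨⟨a, b, r⟩, ⟨c, d, s⟩, sandwich_ofPath r q s, ?_⟩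
    rintro ⟨b', c', n⟩ hn
    obtain ⟨-, ⟨h1, h2⟩, hn⟩ := hM _ hn
    dsimp only at h1 h2
    subst h1 h2
    exact ⟨_, sandwich_ofPath r n s, hlt.sandwich r s hn⟩
  choose m hm hmp using fun n : M t => hrs.2 n.1 n.2
  have := (hfin ⟨t, ht⟩).fintype
  refine ⟨∑ n : M t, (MvPolynomial.X ⟨⟨t, ht⟩, n⟩ : MvPolynomial (Index T M) K) •
    Finsupp.single (m n) 1, sum_mem fun n _ => Submodule.smul_mem _ _
      (Finsupp.single_mem_supported _ _ (hmp n)), mem_universalIdeal.2 fun c => ?_⟩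
  simp only [map_sub, map_sum, specialize_smul, specialize_single_one, MvPolynomial.eval_X,
    ← hm, ← hrs.1, ← map_smul]
  rw [← map_sum, ← map_sub, ← gen_eq_sub_sum (M := M) ⟨t, ht⟩ c]
  exact sandwich_mem (gen_mem_idealOf c ⟨t, ht⟩) r s

/-- Normal forms with polynomial coefficients, simultaneously for all points. -/
theorem exists_universal_normalForm (hlt : IsAdmissibleOrder lt)
    (hM : ∀ t, M t ⊆ nontipsOf T lt t) (hfin : ∀ t : T, (M t.1).Finite) (p : Paths V) :
    ∃ F : Paths V →₀ MvPolynomial (Index T M) K,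
      (∀ c : Index T M → K, specialize c F ∈ pathSpan K (nontips T)) ∧
      (∀ c : Index T M → K, ofPath p - specialize c F ∈ idealSubmodule (idealOf c)) ∧
      (p ∈ nontips T → F = Finsupp.single p 1) := by
  by_cases hp : p ∈ nontips T
  · refine ⟨Finsupp.single p 1, fun c => ?_, fun c => ?_, fun _ => rfl⟩
    · rw [specialize_single_one]
      exact ofPath_mem_pathSpan hp
    · rw [specialize_single_one, sub_self]
      exact zero_mem _
  -- The reduction lemma is used over the polynomial ring, so a single remainder serves all points
  -- c.
  · have h := single_mem_supported_sup hlt.wf hlt.trans (nontips T)ᶜ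
      (universalIdeal (K := K) T M)
      (fun q hq => exists_lower_sub_mem_universalIdeal hlt hM hfin hq) p
    obtain ⟨F, hF, F', hF', hFF'⟩ := Submodule.mem_sup.1 h
    refine ⟨F, fun c => ?_, fun c => ?_, fun h => absurd h hp⟩
    · rw [compl_compl] at hF
      exact pathSpan_mono Set.inter_subset_left (specialize_mem_pathSpan c hF)
    · rw [← specialize_single_one c p, ← hFF', map_add, add_sub_cancel_left]
      exact mem_universalIdeal.1 hF' c

/-- The point condition says that the normal form map at c kills the ideal of c. By linearity it
suffices to test the elements r g_t s, whose normal forms have coefficients polynomial in c. -/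
theorem isAffineVariety_pointsWith (hlt : IsAdmissibleOrder lt) (hT : IsTipReduced T)
    (hM : ∀ t, M t ⊆ nontipsOf T lt t) (hfin : ∀ t : T, (M t.1).Finite) :
    IsAffineVariety (pointsWith K T M lt) := by
  choose F hFspan hFideal hFself using
    exists_universal_normalForm (K := K) hlt hM hfin
  choose E hE using exists_specialize_eq_sandwich_gen (K := K) hfin
  refine isAffineVariety_iff.2 ⟨{f | ∃ r s t q,
    f = Finsupp.linearCombination (MvPolynomial (Index T M) K) F (E r s t) q}, fun c => ?_⟩
  rw [mem_pointsWith_iff hlt hT hM, tips_idealOf_eq_iff hlt hM,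
    and_iff_right fun t => have := (hfin t).to_subtype; Set.toFinite _]
  let N : KQ K V →ₗ[K] KQ K V := lift fun p => specialize c (F p)
  have hNp : ∀ p, N (ofPath p) = specialize c (F p) := fun p => lift_ofPath _ p
  have hNspan : ∀ x, N x ∈ pathSpan K (nontips T) := fun x =>
    (pathSpan_le.2 fun p _ => by
      rw [Submodule.mem_comap, hNp]
      exact hFspan p c : pathSpan K Set.univ ≤ (pathSpan K (nontips T)).comap N)
      (mem_pathSpan_univ x)
  have hNideal : ∀ x, x - N x ∈ idealOf c := fun x =>
    (pathSpan_le.2 fun p _ => by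
      rw [Submodule.mem_comap, LinearMap.sub_apply, LinearMap.id_apply, hNp]
      exact hFideal p c :
        pathSpan K Set.univ ≤ (idealSubmodule (idealOf c)).comap (LinearMap.id - N))
      (mem_pathSpan_univ x)
  -- This uses that the universal normal form of a path in 𝒩 was chosen to be that path.
  have hNself : ∀ x ∈ pathSpan K (nontips T), N x = x := fun x hx =>
    (pathSpan_le.2 fun p hp => by
      rw [LinearMap.mem_eqLocus, hNp, hFself p hp, specialize_single_one, LinearMap.id_apply] :
        pathSpan K (nontips T) ≤ LinearMap.eqLocus N LinearMap.id) hx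
  -- Normalizing with generic coefficients and then evaluating at c agrees with evaluating first and
  -- applying N.
  have hcoeff : ∀ r s t q, MvPolynomial.eval c
      (Finsupp.linearCombination (MvPolynomial (Index T M) K) F (E r s t) q) =
        coeff (N (sandwich r s (gen c t))) q := fun r s t q => by
    rw [← coeff_specialize, specialize_linearCombination, hE]
  constructor
  · rintro h _ ⟨r, s, t, q, rfl⟩
    have hx : sandwich r s (gen c t) ∈ idealOf c := sandwich_mem (gen_mem_idealOf c t) r s
    have hNx : N (sandwich r s (gen c t)) ∈ idealOf c := by
      rw [← sub_sub_cancel (sandwich r s (gen c t)) (N _)]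
      exact (idealOf c).sub_mem hx (hNideal _)
    rw [hcoeff, h _ hNx (hNspan _), coeff_zero]
  · intro h x hx hx'
    rw [← hNself x hx', ← LinearMap.mem_ker]
    -- The kernel of N is only a subspace, but it contains all r g_t s, and these span the ideal.
    refine mem_of_mem_span ?_ hx
    rintro _ ⟨t, rfl⟩ r s
    rw [LinearMap.mem_ker]
    refine ext_coeff fun q => ?_
    rw [← hcoeff, coeff_zero]
    exact h _ ⟨r, s, t, q, rfl⟩

end Equations

end PathAlg

end

/-! ### The theorem on weight homogeneous ideals -/

theorem mainTheorem4 {K : Type w} [Field K] {V : Type u} [Quiver.{v} V]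
    [Fintype V] [∀ a b : V, Finite (a ⟶ b)] {G : Type x} [Group G]
    (lt : PathAlg.Paths V → PathAlg.Paths V → Prop) (hlt : PathAlg.IsAdmissibleOrder lt)
    (W : ∀ {a b : V}, (a ⟶ b) → G)
    (T : Set (PathAlg.Paths V)) (hT : PathAlg.IsTipReduced T)
    (hlen : ∀ t ∈ T, 2 ≤ PathAlg.len t)
    (S : PathAlg.Paths V → Set (PathAlg.Paths V))
    (hS : ∀ t, S t = PathAlg.nontipsOf T lt t \ PathAlg.gradedNontipsOf T lt W t)
    (φ : ∀ t : T, S t.1 → K) (hφ : ∀ t n, φ t n = 0) :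
    -- the points correspond bijectively to the weight homogeneous ideals
    Set.BijOn PathAlg.idealOf (PathAlg.gradedVariety K T lt W) (PathAlg.gradedIdeals K T lt W) ∧
    -- extension by zero is an isomorphism onto the special subvariety
    (∃ Ψ : PathAlg.gradedVariety K T lt W ≃ PathAlg.specialSubvariety T lt S φ,
      (∀ (c : PathAlg.gradedVariety K T lt W) (t : T) (n : PathAlg.nontipsOf T lt t.1),
        (∀ hn : n.1 ∈ PathAlg.gradedNontipsOf T lt W t.1,
          (Ψ c).1 ⟨t, n⟩ = c.1 ⟨t, ⟨n.1, hn⟩⟩) ∧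
        (PathAlg.weight W n.1 ≠ PathAlg.weight W t.1 → (Ψ c).1 ⟨t, n⟩ = 0)) ∧
      PathAlg.IsMorphism Ψ ∧ PathAlg.IsMorphism Ψ.symm) ∧
    -- these sets are affine algebraic varieties
    (T.Finite → (∀ t ∈ T, (PathAlg.gradedNontipsOf T lt W t).Finite) →
      PathAlg.IsAffineVariety (PathAlg.gradedVariety K T lt W)) ∧
    (T.Finite → (∀ t ∈ T, (PathAlg.nontipsOf T lt t).Finite) →
      PathAlg.IsAffineVariety (PathAlg.variety K T lt) ∧
      PathAlg.IsAffineVariety (PathAlg.specialSubvariety T lt S φ)) := by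
  have hgM : ∀ t, PathAlg.gradedNontipsOf T lt W t ⊆ PathAlg.nontipsOf T lt t :=
    PathAlg.gradedNontipsOf_subset W
  have hX : ∀ c, c ∈ PathAlg.specialSubvariety T lt S φ ↔
      c ∈ PathAlg.pointsWith K T (PathAlg.nontipsOf T lt) lt ∧
        ∀ t n, n.1 ∉ PathAlg.gradedNontipsOf T lt W t.1 → c ⟨t, n⟩ = 0 := by
    refine fun c => and_congr_right fun _ => ⟨fun h t n hn => ?_, fun h t n hn => ?_⟩
    · have hnS : n.1 ∈ S t.1 := by
        rw [hS]
        exact ⟨n.2, hn⟩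
      rw [h t n hnS, hφ]
    · rw [hφ]
      rw [hS] at hn
      exact h t n hn.2
  refine ⟨PathAlg.bijOn_idealOf hlt hT W,
    ⟨PathAlg.extendZeroEquiv hgM _ hX, fun c t n => ⟨fun hn => ?_, fun hn => ?_⟩,
      PathAlg.isMorphism_extendZeroEquiv hgM _ hX,
      PathAlg.isMorphism_extendZeroEquiv_symm hgM _ hX⟩,
    fun _ hfin => PathAlg.isAffineVariety_pointsWith hlt hT hgM fun t => hfin t.1 t.2,
    fun _ hfin => ?_⟩
  · exact PathAlg.extendZero_of_mem c.1 t n hn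
  · exact PathAlg.extendZero_of_notMem c.1 t n fun h => hn h.2
  · have hV : PathAlg.IsAffineVariety (PathAlg.variety K T lt) :=
      PathAlg.isAffineVariety_pointsWith hlt hT (fun _ => subset_rfl) fun t => hfin t.1 t.2
    refine ⟨hV, ?_⟩
    -- The special subvariety is cut out of 𝒱_T by the linear equations c_{t,n} = 0 for n outside
    -- 𝒩^W(t).
    have hinter : PathAlg.specialSubvariety T lt S φ = PathAlg.variety K T lt ∩
        {c | ∀ i : {i : PathAlg.Index T (PathAlg.nontipsOf T lt) |
          i.2.1 ∉ PathAlg.gradedNontipsOf T lt W i.1.1}, c i.1 = 0} := by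
      ext c
      rw [hX]
      exact and_congr_right fun _ => ⟨fun h i => h i.1.1 i.1.2 i.2, fun h t n hn => h ⟨⟨t, n⟩, hn⟩⟩
    rw [hinter]
    exact hV.inter (PathAlg.isAffineVariety_coordinates _ _)
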